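/- Let $q\in\mathbb R\setminus\{0\}$ and let $\mathbb C_q[SU_2]$ be the Hopf $*$-algebra generated by $a,b,c,d$ with relations $$ab=q\,ba,\quad ac=q\,ca,\quad bc=cb,\quad bd=q\,db,\quad cd=q\,dc,\quad ad=1+q\,bc,\quad da=1+q^{-1}bc,$$ matrix coproduct $\Delta\begin{pmatrix}a&b\\c&d\end{pmatrix}=\begin{pmatrix}a&b\\c&d\end{pmatrix}\otimes\begin{pmatrix}a&b\\c&d\end{pmatrix}$, counit $\varepsilon(a)=\varepsilon(d)=1$, $\varepsilon(b)=\varepsilon(c)=0$, and involution $a^*=d$, $b^*=-qc$, $c^*=-q^{-1}b$. Let $\pi:\mathbb C_q[SU_2]\to\mathbb C[t,t^{-1}]$ be the Hopf map $\pi(a)=t^{-1}$, $\pi(d)=t$, $\pi(b)=\pi(c)=0$, and put $\mathcal E_k=\{f:(\mathrm{id}\otimes\pi)\Delta f=f\otimes t^k\}$; the Podleś sphere is $\mathbb C_q[S^2]=\mathcal E_0$. Write $b_-=ab$, $b_0=bc$. Let $h$ be the Haar functional of $\mathbb C_q[SU_2]$. Let $\Omega^\bullet_q(S^2)$ be the covariant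 Dolbeault calculus on $\mathbb C_q[S^2]$, $$\Omega^\bullet_q(S^2)=\mathcal E_0\oplus\mathcal E_2\,e^+\oplus\mathcal E_{-2}\,e^-\oplus\mathcal E_0\,e^+\wedge e^-,\qquad e^-\wedge e^+=-q^2\,e^+\wedge e^-,$$ where $e^-=\overline{\mathrm d b_-}$ and $e^+=\overline{\mathrm d(b_-^*)}$ in $\Omega^1/(\mathbb C_q[S^2]^+\Omega^1)$, so that $(e^-)^*=e^+$. Explicitly, let $\lambda_\pm$ be the functionals on $\mathbb C_q[SU_2]$ with $\lambda_\pm(fg)=\kappa(f)\lambda_\pm(g)+\lambda_\pm(f)\varepsilon(g)$, where $\kappa$ is the character $\kappa(a)=q$, $\kappa(d)=q^{-1}$, $\kappa(b)=\kappa(c)=0$, whose only nonzero values on generators are $\lambda_+(c)=-q^{-1}$ and $\lambda_-(b)=q^{-1}$, and let $X_\pm f=f_{(1)}\lambda_\pm(f_{(2)})$. On $\mathbb C_q[S^2]$ this gives $\overline{\mathrm dm}=\lambda_+(m)e^++\lambda_-(m)e^-$. Then $\mathrm d=\partial+\overline\partial$ with $$\partial f=X_+(f)\,e^+,\quad \partial(u\,e^+)=0,\quad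 \partial(v\,e^-)=X_+(v)\,e^+\wedge e^-,$$ $$\overline\partial f=X_-(f)\,e^-,\quad \overline\partial(u\,e^+)=X_-(u)\,e^-\wedge e^+,\quad \overline\partial(v\,e^-)=0,$$ and $\partial,\overline\partial$ vanish on $2$-forms. Equip $\Omega^\bullet_q(S^2)$ with the inner product $\langle\omega,\nu\rangle=h(g(\omega,\nu))$, where $g$ is the sesquilinear metric for which the four summands are orthogonal and $$g(f,f')=ff'^*,\quad g(ue^+,u'e^+)=uu'^*,\quad g(ve^-,v'e^-)=q^2\,vv'^*,\quad g(w\,e^+\wedge e^-,w'\,e^+\wedge e^-)=ww'^*.$$ Then $\mathrm d,\partial,\overline\partial$ have unique adjoints $\mathrm d^*,\partial^*,\overline\partial^*$ for $\langle\cdot,\cdot\rangle$. With $(A,B)=AB+BA$ and $\Delta_T=(T+T^*)^2$ for $T\in\{\mathrm d,\partial,\overline\partial\}$, one has $$(\partial,\overline\partial^*)=(\overline\partial,\partial^*)=0,\qquad(\partial,\partial^*)=(\overline\partial,\overline\partial^*),$$ and $\Delta_{\mathrm d}=2\Delta_\partial=2\Delta_{\overline\partial}$ on $\Omega^\bullet_q(S^2)$.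 -/

import Mathlib

open scoped TensorProduct LaurentPolynomial

noncomputable section

namespace Podles

/-! ### The Hopf `*`-algebra `ℂ_q[SU₂]`, for a nonzero real number `q` -/

/-- The four matrix coefficients generating `ℂ_q[SL₂]`. -/
inductive Gen
  | a | b | c | d

/-- The deformation parameter as a complex number. -/
def qc (q : ℝˣ) : ℂ := ((q : ℝ) : ℂ)

theorem qc_ne (q : ℝˣ) : qc q ≠ 0 := by
  simp [qc]

/-- The defining relations of `ℂ_q[SL₂]`, for four elements of a complex algebra. -/
structure Relations (q : ℝˣ) {A : Type*} [Ring A] [Algebra ℂ A] (a b c d : A) : Prop where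
  ab : a * b = qc q • (b * a)
  ac : a * c = qc q • (c * a)
  bc : b * c = c * b
  bd : b * d = qc q • (d * b)
  cd : c * d = qc q • (d * c)
  ad : a * d = 1 + qc q • (b * c)
  da : d * a = 1 + (qc q)⁻¹ • (b * c)

/-- The relations imposed on the free algebra. -/
inductive Rel (q : ℝˣ) : FreeAlgebra ℂ Gen → FreeAlgebra ℂ Gen → Prop
  | ab : Rel q (FreeAlgebra.ι ℂ Gen.a * FreeAlgebra.ι ℂ Gen.b)
      (qc q • (FreeAlgebra.ι ℂ Gen.b * FreeAlgebra.ι ℂ Gen.a))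
  | ac : Rel q (FreeAlgebra.ι ℂ Gen.a * FreeAlgebra.ι ℂ Gen.c)
      (qc q • (FreeAlgebra.ι ℂ Gen.c * FreeAlgebra.ι ℂ Gen.a))
  | bc : Rel q (FreeAlgebra.ι ℂ Gen.b * FreeAlgebra.ι ℂ Gen.c)
      (FreeAlgebra.ι ℂ Gen.c * FreeAlgebra.ι ℂ Gen.b)
  | bd : Rel q (FreeAlgebra.ι ℂ Gen.b * FreeAlgebra.ι ℂ Gen.d)
      (qc q • (FreeAlgebra.ι ℂ Gen.d * FreeAlgebra.ι ℂ Gen.b))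
  | cd : Rel q (FreeAlgebra.ι ℂ Gen.c * FreeAlgebra.ι ℂ Gen.d)
      (qc q • (FreeAlgebra.ι ℂ Gen.d * FreeAlgebra.ι ℂ Gen.c))
  | ad : Rel q (FreeAlgebra.ι ℂ Gen.a * FreeAlgebra.ι ℂ Gen.d)
      (1 + qc q • (FreeAlgebra.ι ℂ Gen.b * FreeAlgebra.ι ℂ Gen.c))
  | da : Rel q (FreeAlgebra.ι ℂ Gen.d * FreeAlgebra.ι ℂ Gen.a)
      (1 + (qc q)⁻¹ • (FreeAlgebra.ι ℂ Gen.b * FreeAlgebra.ι ℂ Gen.c))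

/-- The algebra `ℂ_q[SU₂]` (as an algebra, `ℂ_q[SL₂]`). -/
def SU (q : ℝˣ) : Type := RingQuot (Rel q)

instance (q : ℝˣ) : Ring (SU q) := inferInstanceAs (Ring (RingQuot (Rel q)))

instance (q : ℝˣ) : Algebra ℂ (SU q) := inferInstanceAs (Algebra ℂ (RingQuot (Rel q)))

/-- The quotient map from the free algebra. -/
def mk (q : ℝˣ) : FreeAlgebra ℂ Gen →ₐ[ℂ] SU q :=
  (RingQuot.mkAlgHom ℂ (Rel q) : FreeAlgebra ℂ Gen →ₐ[ℂ] RingQuot (Rel q))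

theorem mk_rel {q : ℝˣ} {x y : FreeAlgebra ℂ Gen} (h : Rel q x y) : mk q x = mk q y :=
  RingQuot.mkAlgHom_rel ℂ h

/-- The generators of `ℂ_q[SU₂]`. -/
def gen (q : ℝˣ) (x : Gen) : SU q := mk q (FreeAlgebra.ι ℂ x)

theorem gen_relations (q : ℝˣ) :
    Relations q (gen q Gen.a) (gen q Gen.b) (gen q Gen.c) (gen q Gen.d) := by
  constructor
  · simpa [gen] using mk_rel (Rel.ab (q := q))
  · simpa [gen] using mk_rel (Rel.ac (q := q))
  · simpa [gen] using mk_rel (Rel.bc (q := q))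
  · simpa [gen] using mk_rel (Rel.bd (q := q))
  · simpa [gen] using mk_rel (Rel.cd (q := q))
  · simpa [gen] using mk_rel (Rel.ad (q := q))
  · simpa [gen] using mk_rel (Rel.da (q := q))

/-- A choice of value for each generator. -/
def Gen.elim4 {A : Type*} (a b c d : A) : Gen → A
  | Gen.a => a
  | Gen.b => b
  | Gen.c => c
  | Gen.d => d

/-- The algebra map out of `ℂ_q[SU₂]` determined by four elements satisfying the relations. -/
def lift {q : ℝˣ} {A : Type*} [Ring A] [Algebra ℂ A] (a b c d : A)
    (h : Relations q a b c d) : SU q →ₐ[ℂ] A :=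
  (RingQuot.liftAlgHom ℂ ⟨FreeAlgebra.lift ℂ (Gen.elim4 a b c d), by
    intro x y hxy
    cases hxy <;> simp [Gen.elim4, h.ab, h.ac, h.bc, h.bd, h.cd, h.ad, h.da]⟩ :
    RingQuot (Rel q) →ₐ[ℂ] A)

@[simp] theorem lift_gen {q : ℝˣ} {A : Type*} [Ring A] [Algebra ℂ A] (a b c d : A)
    (h : Relations q a b c d) (x : Gen) : lift a b c d h (gen q x) = Gen.elim4 a b c d x := by
  unfold lift gen mk
  erw [RingQuot.liftAlgHom_mkAlgHom_apply]
  simp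

theorem algHom_ext {q : ℝˣ} {A : Type*} [Ring A] [Algebra ℂ A] {f g : SU q →ₐ[ℂ] A}
    (ha : f (gen q Gen.a) = g (gen q Gen.a)) (hb : f (gen q Gen.b) = g (gen q Gen.b))
    (hc : f (gen q Gen.c) = g (gen q Gen.c)) (hd : f (gen q Gen.d) = g (gen q Gen.d)) :
    f = g := by
  refine RingQuot.ringQuot_ext' ℂ (A := FreeAlgebra ℂ Gen) (s := Rel q) f g ?_
  refine FreeAlgebra.hom_ext ?_
  funext x
  cases x
  · exact ha
  · exact hb
  · exact hc
  · exact hd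

/-- The coproduct as an algebra map. -/
def comulHom (q : ℝˣ) : SU q →ₐ[ℂ] SU q ⊗[ℂ] SU q :=
  lift
    (gen q Gen.a ⊗ₜ gen q Gen.a + gen q Gen.b ⊗ₜ gen q Gen.c)
    (gen q Gen.a ⊗ₜ gen q Gen.b + gen q Gen.b ⊗ₜ gen q Gen.d)
    (gen q Gen.c ⊗ₜ gen q Gen.a + gen q Gen.d ⊗ₜ gen q Gen.c)
    (gen q Gen.c ⊗ₜ gen q Gen.b + gen q Gen.d ⊗ₜ gen q Gen.d)
    (by
      have h := gen_relations q
      have hq := qc_ne q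
      constructor <;>
      simp only [mul_add, add_mul, Algebra.TensorProduct.tmul_mul_tmul, h.ab, h.ac, h.bd, h.cd,
        h.ad, h.da, ← h.bc, smul_add, ← TensorProduct.smul_tmul', TensorProduct.tmul_smul,
        TensorProduct.tmul_add, TensorProduct.add_tmul, smul_smul,
        Algebra.TensorProduct.one_def] <;>
      match_scalars <;> (try field_simp))

/-- The counit as an algebra map. -/
def counitHom (q : ℝˣ) : SU q →ₐ[ℂ] ℂ :=
  lift 1 0 0 1 (by constructor <;> simp)

/-- The bialgebra structure of `ℂ_q[SU₂]`. -/
instance (q : ℝˣ) : Bialgebra ℂ (SU q) :=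
  Bialgebra.ofAlgHom (comulHom q) (counitHom q)
    (by
      apply algHom_ext <;>
      simp [comulHom, Gen.elim4, TensorProduct.tmul_add, TensorProduct.add_tmul] <;> abel)
    (by apply algHom_ext <;> simp [comulHom, counitHom, Gen.elim4])
    (by apply algHom_ext <;> simp [comulHom, counitHom, Gen.elim4])

/-- The opposite algebra of `ℂ_q[SU₂]`, on which `ℂ` acts through complex conjugation. -/
def ConjOp (q : ℝˣ) : Type := (SU q)ᵐᵒᵖ

instance (q : ℝˣ) : Ring (ConjOp q) := inferInstanceAs (Ring (SU q)ᵐᵒᵖ)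

instance (q : ℝˣ) : Algebra ℂ (ConjOp q) := Algebra.compHom (SU q)ᵐᵒᵖ (starRingEnd ℂ)

/-- An element of `ℂ_q[SU₂]` as an element of the conjugate opposite algebra. -/
def toConjOp {q : ℝˣ} (x : SU q) : ConjOp q := MulOpposite.op x

/-- An element of the conjugate opposite algebra as an element of `ℂ_q[SU₂]`. -/
def ofConjOp {q : ℝˣ} (x : ConjOp q) : SU q := MulOpposite.unop x

theorem toConjOp_mul {q : ℝˣ} (x y : SU q) : toConjOp x * toConjOp y = toConjOp (y * x) := rfl

theorem toConjOp_add {q : ℝˣ} (x y : SU q) : toConjOp x + toConjOp y = toConjOp (x + y) := rfl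

theorem toConjOp_one {q : ℝˣ} : (1 : ConjOp q) = toConjOp 1 := rfl

theorem smul_toConjOp {q : ℝˣ} (r : ℂ) (x : SU q) :
    r • toConjOp x = toConjOp (starRingEnd ℂ r • x) := rfl

/-- The involution of `ℂ_q[SU₂]` as an algebra map to the conjugate opposite algebra, determined by
`a* = d`, `b* = -q c`, `c* = -q⁻¹ b`, `d* = a`. -/
def starHom (q : ℝˣ) : SU q →ₐ[ℂ] ConjOp q :=
  lift
    (toConjOp (gen q Gen.d))
    (toConjOp ((-qc q) • gen q Gen.c))
    (toConjOp ((-(qc q)⁻¹) • gen q Gen.b))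
    (toConjOp (gen q Gen.a))
    (by
      have h := gen_relations q
      have hq := qc_ne q
      have hs : starRingEnd ℂ (qc q) = qc q := by simp [qc]
      constructor <;>
      simp only [toConjOp_mul, toConjOp_one, smul_toConjOp, toConjOp_add, hs, map_inv₀] <;>
      refine congrArg toConjOp ?_ <;>
      simp only [smul_mul_assoc, mul_smul_comm,
        h.ab, h.ac, h.bd, h.cd, h.ad, h.da, ← h.bc, smul_smul] <;>
      match_scalars <;> field_simp)

/-- The involution of `ℂ_q[SU₂]`. -/
def adj {q : ℝˣ} (f : SU q) : SU q := ofConjOp (starHom q f)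

/-! ### The Podleś sphere and the line bundles `ℰ_k` -/

theorem laurent_relations (q : ℝˣ) :
    Relations q (LaurentPolynomial.T (-1) : ℂ[T;T⁻¹]) 0 0 (LaurentPolynomial.T 1) := by
  constructor <;> simp only [mul_zero, zero_mul, smul_zero, add_zero] <;>
    rw [← LaurentPolynomial.T_add] <;> simp

/-- The Hopf algebra map `π : ℂ_q[SU₂] → ℂ[U₁] = ℂ[t, t⁻¹]`. -/
def proj (q : ℝˣ) : SU q →ₐ[ℂ] ℂ[T;T⁻¹] :=
  lift (LaurentPolynomial.T (-1)) 0 0 (LaurentPolynomial.T 1) (laurent_relations q)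

/-- The right coaction `Δ_π = (id ⊗ π) ∘ Δ`. -/
def coact (q : ℝˣ) : SU q →ₐ[ℂ] SU q ⊗[ℂ] ℂ[T;T⁻¹] :=
  (Algebra.TensorProduct.map (AlgHom.id ℂ (SU q)) (proj q)).comp (Bialgebra.comulAlgHom ℂ (SU q))

/-- The degree-`k` part `ℰ_k = {f | Δ_π f = f ⊗ t ^ k}`; the Podleś sphere `ℂ_q[S²]` is `ℰ_0`. -/
def E (q : ℝˣ) (k : ℤ) : Submodule ℂ (SU q) :=
  LinearMap.eqLocus (coact q).toLinearMap
    ((TensorProduct.mk ℂ (SU q) ℂ[T;T⁻¹]).flip (LaurentPolynomial.T k))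

theorem mem_E {q : ℝˣ} {k : ℤ} {f : SU q} :
    f ∈ E q k ↔ coact q f = f ⊗ₜ LaurentPolynomial.T k := Iff.rfl

/-! ### The Haar functional -/

/-- The vector space with basis `[i, j, k]`, standing for `a ^ i b ^ j c ^ k` when `0 ≤ i` and for
`d ^ (-i) b ^ j c ^ k` when `i ≤ 0`. -/
abbrev PBW : Type := ℤ × ℕ × ℕ →₀ ℂ

/-- Left multiplication by `a` on normally ordered monomials. -/
def mulA (q : ℝˣ) : PBW →ₗ[ℂ] PBW :=
  Finsupp.linearCombination ℂ fun m : ℤ × ℕ × ℕ =>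
    if 0 ≤ m.1 then Finsupp.single (m.1 + 1, m.2.1, m.2.2) 1
    else Finsupp.single (m.1 + 1, m.2.1, m.2.2) 1 +
      Finsupp.single (m.1 + 1, m.2.1 + 1, m.2.2 + 1) (qc q ^ (-2 * m.1 - 1))

/-- Left multiplication by `b` on normally ordered monomials. -/
def mulB (q : ℝˣ) : PBW →ₗ[ℂ] PBW :=
  Finsupp.linearCombination ℂ fun m : ℤ × ℕ × ℕ =>
    Finsupp.single (m.1, m.2.1 + 1, m.2.2) (qc q ^ (-m.1))

/-- Left multiplication by `c` on normally ordered monomials. -/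
def mulC (q : ℝˣ) : PBW →ₗ[ℂ] PBW :=
  Finsupp.linearCombination ℂ fun m : ℤ × ℕ × ℕ =>
    Finsupp.single (m.1, m.2.1, m.2.2 + 1) (qc q ^ (-m.1))

/-- Left multiplication by `d` on normally ordered monomials. -/
def mulD (q : ℝˣ) : PBW →ₗ[ℂ] PBW :=
  Finsupp.linearCombination ℂ fun m : ℤ × ℕ × ℕ =>
    if m.1 ≤ 0 then Finsupp.single (m.1 - 1, m.2.1, m.2.2) 1
    else Finsupp.single (m.1 - 1, m.2.1, m.2.2) 1 +
      Finsupp.single (m.1 - 1, m.2.1 + 1, m.2.2 + 1) (qc q ^ (1 - 2 * m.1))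

theorem mulA_single (q : ℝˣ) (i : ℤ) (j k : ℕ) (x : ℂ) :
    mulA q (Finsupp.single (i, j, k) x) =
      if 0 ≤ i then Finsupp.single (i + 1, j, k) x
      else Finsupp.single (i + 1, j, k) x +
        Finsupp.single (i + 1, j + 1, k + 1) (x * qc q ^ (-2 * i - 1)) := by
  simp [mulA, smul_add]

theorem mulB_single (q : ℝˣ) (i : ℤ) (j k : ℕ) (x : ℂ) :
    mulB q (Finsupp.single (i, j, k) x) = Finsupp.single (i, j + 1, k) (x * qc q ^ (-i)) := by
  simp [mulB]

theorem mulC_single (q : ℝˣ) (i : ℤ) (j k : ℕ) (x : ℂ) :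
    mulC q (Finsupp.single (i, j, k) x) = Finsupp.single (i, j, k + 1) (x * qc q ^ (-i)) := by
  simp [mulC]

theorem mulD_single (q : ℝˣ) (i : ℤ) (j k : ℕ) (x : ℂ) :
    mulD q (Finsupp.single (i, j, k) x) =
      if i ≤ 0 then Finsupp.single (i - 1, j, k) x
      else Finsupp.single (i - 1, j, k) x +
        Finsupp.single (i - 1, j + 1, k + 1) (x * qc q ^ (1 - 2 * i)) := by
  simp [mulD, smul_add]

theorem pbw_relations (q : ℝˣ) :
    Relations q (A := Module.End ℂ PBW) (mulA q) (mulB q) (mulC q) (mulD q) := by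
  have hq := qc_ne q
  constructor <;> refine Finsupp.lhom_ext' fun ⟨i, j, k⟩ => LinearMap.ext_ring ?_
  all_goals
    simp only [LinearMap.comp_apply, Module.End.mul_apply, LinearMap.smul_apply,
      LinearMap.add_apply, Module.End.one_apply, Finsupp.lsingle_apply,
      mulA_single, mulB_single, mulC_single, mulD_single] <;>
    (try split_ifs) <;>
    (try simp only [map_add, mulA_single, mulB_single, mulC_single, mulD_single]) <;>
    (try split_ifs) <;> (try omega) <;>
    (try simp only [smul_add, Finsupp.smul_single, smul_eq_mul, one_mul, sub_add_cancel,
      add_sub_cancel_right, two_mul, neg_mul, neg_add_rev, neg_sub, zpow_add₀ hq, zpow_sub₀ hq,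
      zpow_neg, zpow_one, mul_sub, mul_add]) <;>
    (try field_simp)

/-- The action of `ℂ_q[SU₂]` by left multiplication on normally ordered monomials. -/
def pbwRep (q : ℝˣ) : SU q →ₐ[ℂ] Module.End ℂ PBW :=
  lift (mulA q) (mulB q) (mulC q) (mulD q) (pbw_relations q)

/-- The coordinates of an element in the basis of normally ordered monomials. -/
def normalForm (q : ℝˣ) : SU q →ₗ[ℂ] PBW :=
  (LinearMap.applyₗ (Finsupp.single (0, 0, 0) 1)).comp (pbwRep q).toLinearMap

/-- The Haar functional `h` (the normalised invariant functional) by its values: in the monomial basis it vanishes except on the powers of `b c`, where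
`h((b c) ^ n) = (-q) ^ n / (1 + q ^ 2 + ⋯ + q ^ (2 n))`. -/
def haar (q : ℝˣ) : SU q →ₗ[ℂ] ℂ :=
  (Finsupp.linearCombination ℂ fun m : ℤ × ℕ × ℕ =>
    if m.1 = 0 ∧ m.2.1 = m.2.2 then
      (-qc q) ^ m.2.1 / ∑ r ∈ Finset.range (m.2.1 + 1), qc q ^ (2 * r)
    else 0).comp (normalForm q)

/-! ### The calculus -/

/-- The two-dimensional representation whose upper right entry is `lamPlus`. -/
def repPlus (q : ℝˣ) : SU q →ₐ[ℂ] Matrix (Fin 2) (Fin 2) ℂ :=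
  lift !![qc q, 0; 0, 1] 0 !![0, -(qc q)⁻¹; 0, 0] !![(qc q)⁻¹, 0; 0, 1] (by
    have hq := qc_ne q
    constructor <;> ext i j <;> fin_cases i <;> fin_cases j <;>
      simp [Matrix.mul_apply, Fin.sum_univ_two, hq])

/-- The two-dimensional representation whose upper right entry is `lamMinus`. -/
def repMinus (q : ℝˣ) : SU q →ₐ[ℂ] Matrix (Fin 2) (Fin 2) ℂ :=
  lift !![qc q, 0; 0, 1] !![0, (qc q)⁻¹; 0, 0] 0 !![(qc q)⁻¹, 0; 0, 1] (by
    have hq := qc_ne q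
    constructor <;> ext i j <;> fin_cases i <;> fin_cases j <;>
      simp [Matrix.mul_apply, Fin.sum_univ_two, hq])

/-- The functional `λ₊`. On the Podleś sphere, where the diagonal entries of the representation are
both the counit, it is the derivation at the counit with `λ₊(b₋*) = 1`, `λ₊(b₀) = λ₊(b₋) = 0`, for
`b₋ = a b` and `b₀ = b c`. In the quotient of the one-forms by `ℂ_q[S²]⁺ Ω¹` the class of `dm` is
`λ₊(m) e⁺ + λ₋(m) e⁻`, with basis `e⁻ = [d b₋]` and `e⁺ = [d(b₋*)]`, so that `(e⁻)* = e⁺`. -/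
def lamPlus (q : ℝˣ) : SU q →ₗ[ℂ] ℂ :=
  (Matrix.entryLinearMap ℂ ℂ 0 1).comp (repPlus q).toLinearMap

/-- The functional `λ₋`. On the Podleś sphere it is the derivation at the counit with
`λ₋(b₋) = 1`, `λ₋(b₀) = λ₋(b₋*) = 0`. -/
def lamMinus (q : ℝˣ) : SU q →ₗ[ℂ] ℂ :=
  (Matrix.entryLinearMap ℂ ℂ 0 1).comp (repMinus q).toLinearMap

theorem lamPlus_values (q : ℝˣ) :
    lamPlus q (adj (gen q Gen.a * gen q Gen.b)) = 1 ∧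
    lamPlus q (gen q Gen.b * gen q Gen.c) = 0 ∧ lamPlus q (gen q Gen.a * gen q Gen.b) = 0 := by
  have hq := qc_ne q
  have h : adj (gen q Gen.a * gen q Gen.b) = ((-qc q) • gen q Gen.c) * gen q Gen.d := by
    unfold adj
    rw [map_mul]
    simp only [starHom, lift_gen, Gen.elim4]
    rfl
  rw [h]
  simp [lamPlus, repPlus, Gen.elim4, hq]

theorem lamMinus_values (q : ℝˣ) :
    lamMinus q (gen q Gen.a * gen q Gen.b) = 1 ∧ lamMinus q (gen q Gen.b * gen q Gen.c) = 0 ∧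
    lamMinus q (adj (gen q Gen.a * gen q Gen.b)) = 0 := by
  have hq := qc_ne q
  have h : adj (gen q Gen.a * gen q Gen.b) = ((-qc q) • gen q Gen.c) * gen q Gen.d := by
    unfold adj
    rw [map_mul]
    simp only [starHom, lift_gen, Gen.elim4]
    rfl
  rw [h]
  simp [lamMinus, repMinus, Gen.elim4, hq]

/-- The operator `f ↦ f₍₁₎ lam(f₍₂₎)` attached to a functional `lam`. -/
def convolve {q : ℝˣ} (lam : SU q →ₗ[ℂ] ℂ) : SU q →ₗ[ℂ] SU q :=
  (TensorProduct.rid ℂ (SU q)).toLinearMap ∘ₗ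
    (LinearMap.lTensor (SU q) lam) ∘ₗ (Coalgebra.comul (R := ℂ) (A := SU q))

theorem mk_surjective (q : ℝˣ) : Function.Surjective (mk q) :=
  RingQuot.mkAlgHom_surjective ℂ (Rel q)

theorem induction {q : ℝˣ} {P : SU q → Prop} (hr : ∀ r : ℂ, P (algebraMap ℂ (SU q) r))
    (hg : ∀ x : Gen, P (gen q x)) (hm : ∀ f g, P f → P g → P (f * g))
    (ha : ∀ f g, P f → P g → P (f + g)) (f : SU q) : P f := by
  obtain ⟨x, rfl⟩ := mk_surjective q f
  induction x using FreeAlgebra.induction with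
  | grade0 r => simpa using hr r
  | grade1 x => exact hg x
  | mul x y hx hy => simpa using hm _ _ hx hy
  | add x y hx hy => simpa using ha _ _ hx hy

/-- The algebra map `f ⊗ g ↦ p(f) R(g)` into matrices over `B`. -/
def projRep {q : ℝˣ} {B : Type*} [CommRing B] [Algebra ℂ B] (p : SU q →ₐ[ℂ] B)
    (R : SU q →ₐ[ℂ] Matrix (Fin 2) (Fin 2) ℂ) :
    SU q ⊗[ℂ] SU q →ₐ[ℂ] Matrix (Fin 2) (Fin 2) B :=
  Algebra.TensorProduct.lift
    (((Algebra.ofId B (Matrix (Fin 2) (Fin 2) B)).restrictScalars ℂ).comp p)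
    ((Algebra.ofId ℂ B).mapMatrix.comp R)
    (fun x _ => Algebra.commute_algebraMap_left (p x) _)

/-- The algebra map `f ⊗ g ↦ R(f) p(g)` into matrices over `B`. -/
def repProj {q : ℝˣ} {B : Type*} [CommRing B] [Algebra ℂ B] (p : SU q →ₐ[ℂ] B)
    (R : SU q →ₐ[ℂ] Matrix (Fin 2) (Fin 2) ℂ) :
    SU q ⊗[ℂ] SU q →ₐ[ℂ] Matrix (Fin 2) (Fin 2) B :=
  Algebra.TensorProduct.lift
    ((Algebra.ofId ℂ B).mapMatrix.comp R)
    (((Algebra.ofId B (Matrix (Fin 2) (Fin 2) B)).restrictScalars ℂ).comp p)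
    (fun _ y => Algebra.commute_algebraMap_right (p y) _)

theorem projRep_tmul {q : ℝˣ} {B : Type*} [CommRing B] [Algebra ℂ B] (p : SU q →ₐ[ℂ] B)
    (R : SU q →ₐ[ℂ] Matrix (Fin 2) (Fin 2) ℂ) (f g : SU q) (i j : Fin 2) :
    projRep p R (f ⊗ₜ g) i j = R g i j • p f := by
  rw [projRep]
  erw [Algebra.TensorProduct.lift_tmul]
  simp [Algebra.ofId_apply, Matrix.algebraMap_eq_diagonal, Algebra.smul_def, mul_comm,
    Matrix.diagonal_mul]

theorem repProj_tmul {q : ℝˣ} {B : Type*} [CommRing B] [Algebra ℂ B] (p : SU q →ₐ[ℂ] B)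
    (R : SU q →ₐ[ℂ] Matrix (Fin 2) (Fin 2) ℂ) (f g : SU q) (i j : Fin 2) :
    repProj p R (f ⊗ₜ g) i j = R f i j • p g := by
  rw [repProj]
  erw [Algebra.TensorProduct.lift_tmul]
  simp [Algebra.ofId_apply, Matrix.algebraMap_eq_diagonal, Algebra.smul_def, mul_comm,
    Matrix.mul_diagonal]

theorem comul_gen (q : ℝˣ) :
    Coalgebra.comul (R := ℂ) (gen q Gen.a) =
        gen q Gen.a ⊗ₜ[ℂ] gen q Gen.a + gen q Gen.b ⊗ₜ gen q Gen.c ∧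
      Coalgebra.comul (R := ℂ) (gen q Gen.b) =
        gen q Gen.a ⊗ₜ[ℂ] gen q Gen.b + gen q Gen.b ⊗ₜ gen q Gen.d ∧
      Coalgebra.comul (R := ℂ) (gen q Gen.c) =
        gen q Gen.c ⊗ₜ[ℂ] gen q Gen.a + gen q Gen.d ⊗ₜ gen q Gen.c ∧
      Coalgebra.comul (R := ℂ) (gen q Gen.d) =
        gen q Gen.c ⊗ₜ[ℂ] gen q Gen.b + gen q Gen.d ⊗ₜ gen q Gen.d := by
  refine ⟨?_, ?_, ?_, ?_⟩ <;> exact lift_gen _ _ _ _ _ _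

theorem intertwine {q : ℝˣ} {B : Type*} [CommRing B] [Algebra ℂ B] (p : SU q →ₐ[ℂ] B)
    (R : SU q →ₐ[ℂ] Matrix (Fin 2) (Fin 2) ℂ) (D : Matrix (Fin 2) (Fin 2) B)
    (h : ∀ x : Gen, projRep p R (Coalgebra.comul (R := ℂ) (gen q x)) * D =
      D * repProj p R (Coalgebra.comul (R := ℂ) (gen q x))) (f : SU q) :
    projRep p R (Coalgebra.comul (R := ℂ) f) * D =
      D * repProj p R (Coalgebra.comul (R := ℂ) f) := by
  induction f using induction with
  | hr r =>
    rw [Bialgebra.comul_algebraMap, AlgHom.commutes, AlgHom.commutes, Algebra.commutes]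
  | hg x => exact h x
  | hm f g hf hg =>
    rw [Bialgebra.comul_mul, map_mul, map_mul, mul_assoc, hg, ← mul_assoc, hf, mul_assoc]
  | ha f g hf hg => simp only [map_add, add_mul, mul_add, hf, hg]

/-- If `π(f₍₁₎) R(f₍₂₎)₀₁ = u R(f₍₁₎)₀₁ π(f₍₂₎)`, then `f ↦ f₍₁₎ R(f₍₂₎)₀₁` multiplies the second
leg of the coaction by `u`. -/
theorem map_convolve {q : ℝˣ} {B : Type*} [CommRing B] [Algebra ℂ B] (p : SU q →ₐ[ℂ] B)
    (lam : SU q →ₗ[ℂ] ℂ) (u : B) (L₁ L₂ : SU q ⊗[ℂ] SU q →ₗ[ℂ] B)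
    (h₁ : ∀ f g, L₁ (f ⊗ₜ g) = lam g • p f) (h₂ : ∀ f g, L₂ (f ⊗ₜ g) = lam f • p g)
    (h : ∀ f, L₁ (Coalgebra.comul (R := ℂ) f) = u * L₂ (Coalgebra.comul (R := ℂ) f)) (f : SU q) :
    LinearMap.lTensor (SU q) p.toLinearMap (Coalgebra.comul (R := ℂ) (convolve lam f)) =
      LinearMap.lTensor (SU q) (LinearMap.mulLeft ℂ u)
        (TensorProduct.map (convolve lam) p.toLinearMap (Coalgebra.comul (R := ℂ) f)) := by
  have e1 : ∀ w : SU q ⊗[ℂ] SU q,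
      LinearMap.lTensor (SU q) p.toLinearMap (Coalgebra.comul (R := ℂ)
        (TensorProduct.rid ℂ (SU q) (LinearMap.lTensor (SU q) lam w))) =
      LinearMap.lTensor (SU q) L₁ (TensorProduct.assoc ℂ _ _ _
        (LinearMap.rTensor (SU q) (Coalgebra.comul (R := ℂ)) w)) := by
    intro w
    induction w with
    | zero => simp
    | add x y hx hy => simp only [map_add, hx, hy]
    | tmul x y =>
      simp only [LinearMap.lTensor_tmul, TensorProduct.rid_tmul, map_smul, LinearMap.rTensor_tmul]
      induction Coalgebra.comul (R := ℂ) x with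
      | zero => simp
      | add a b ha hb => simp only [map_add, smul_add, TensorProduct.add_tmul, ha, hb]
      | tmul a b => simp [h₁]
  have e2 : ∀ w : SU q ⊗[ℂ] SU q,
      LinearMap.lTensor (SU q) L₂ (TensorProduct.assoc ℂ _ _ _
        (LinearMap.rTensor (SU q) (Coalgebra.comul (R := ℂ)) w)) =
      TensorProduct.map (convolve lam) p.toLinearMap w := by
    intro w
    induction w with
    | zero => simp
    | add x y hx hy => simp only [map_add, hx, hy]
    | tmul x y =>
      simp only [TensorProduct.map_tmul, LinearMap.rTensor_tmul, convolve, LinearMap.comp_apply,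
        LinearEquiv.coe_coe]
      induction Coalgebra.comul (R := ℂ) x with
      | zero => simp
      | add a b ha hb => simp only [map_add, TensorProduct.add_tmul, ha, hb]
      | tmul a b => simp [h₂, TensorProduct.smul_tmul']
  have e3 : ∀ w : SU q ⊗[ℂ] SU q,
      LinearMap.lTensor (SU q) L₁ (LinearMap.lTensor (SU q) (Coalgebra.comul (R := ℂ)) w) =
      LinearMap.lTensor (SU q) (LinearMap.mulLeft ℂ u) (LinearMap.lTensor (SU q) L₂
        (LinearMap.lTensor (SU q) (Coalgebra.comul (R := ℂ)) w)) := by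
    intro w
    induction w with
    | zero => simp
    | add x y hx hy => simp only [map_add, hx, hy]
    | tmul x y => simp [h]
  change LinearMap.lTensor (SU q) p.toLinearMap (Coalgebra.comul (R := ℂ)
        (TensorProduct.rid ℂ (SU q) (LinearMap.lTensor (SU q) lam (Coalgebra.comul (R := ℂ) f)))) = _
  rw [e1, Coalgebra.coassoc_apply, e3, ← Coalgebra.coassoc_apply, e2]

theorem coact_eq {q : ℝˣ} (f : SU q) :
    coact q f = LinearMap.lTensor (SU q) (proj q).toLinearMap (Coalgebra.comul (R := ℂ) f) := rfl

theorem convolve_mem {q : ℝˣ} (R : SU q →ₐ[ℂ] Matrix (Fin 2) (Fin 2) ℂ) (n : ℤ)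
    (h : ∀ x : Gen, projRep (proj q) R (Coalgebra.comul (R := ℂ) (gen q x)) *
        Matrix.diagonal ![LaurentPolynomial.T n, 1] =
      Matrix.diagonal ![LaurentPolynomial.T n, 1] *
        repProj (proj q) R (Coalgebra.comul (R := ℂ) (gen q x)))
    {k : ℤ} {f : SU q} (hf : f ∈ E q k) :
    convolve ((Matrix.entryLinearMap ℂ ℂ 0 1).comp R.toLinearMap) f ∈ E q (k + n) := by
  rw [mem_E, coact_eq] at hf ⊢
  rw [map_convolve (proj q) _ (LaurentPolynomial.T n)
    ((Matrix.entryLinearMap ℂ _ 0 1).comp (projRep (proj q) R).toLinearMap)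
    ((Matrix.entryLinearMap ℂ _ 0 1).comp (repProj (proj q) R).toLinearMap)]
  · have : TensorProduct.map (convolve ((Matrix.entryLinearMap ℂ ℂ 0 1).comp R.toLinearMap))
        (proj q).toLinearMap (Coalgebra.comul (R := ℂ) f) =
      LinearMap.rTensor _ (convolve ((Matrix.entryLinearMap ℂ ℂ 0 1).comp R.toLinearMap))
        (LinearMap.lTensor (SU q) (proj q).toLinearMap (Coalgebra.comul (R := ℂ) f)) := by
      rw [← LinearMap.rTensor_comp_lTensor]
      rfl
    rw [this, hf]
    rw [LinearMap.rTensor_tmul, LinearMap.lTensor_tmul, LinearMap.mulLeft_apply,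
      ← LaurentPolynomial.T_add, add_comm]
  · intro f g
    simp [projRep_tmul]
  · intro f g
    simp [repProj_tmul]
  · intro f
    have := congrFun (congrFun (intertwine (proj q) R _ h f) 0) 1
    simpa using this

theorem repPlus_intertwine {q : ℝˣ} {B : Type*} [CommRing B] [Algebra ℂ B] (p : SU q →ₐ[ℂ] B)
    (u : B) (hb' : p (gen q Gen.b) = 0) (hc' : p (gen q Gen.c) = 0)
    (hu : u * p (gen q Gen.a) = p (gen q Gen.d)) (x : Gen) :
    projRep p (repPlus q) (Coalgebra.comul (R := ℂ) (gen q x)) * Matrix.diagonal ![u, 1] =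
      Matrix.diagonal ![u, 1] * repProj p (repPlus q) (Coalgebra.comul (R := ℂ) (gen q x)) := by
  obtain ⟨ha, hb, hc, hd⟩ := comul_gen q
  cases x <;> ext i j : 2 <;> fin_cases i <;> fin_cases j <;>
    simp [ha, hb, hc, hd, hb', hc', ← hu, projRep_tmul, repProj_tmul, Matrix.mul_diagonal,
      Matrix.diagonal_mul, repPlus, Gen.elim4, mul_comm]

theorem repMinus_intertwine {q : ℝˣ} {B : Type*} [CommRing B] [Algebra ℂ B] (p : SU q →ₐ[ℂ] B)
    (u : B) (hb' : p (gen q Gen.b) = 0) (hc' : p (gen q Gen.c) = 0)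
    (hu : u * p (gen q Gen.d) = p (gen q Gen.a)) (x : Gen) :
    projRep p (repMinus q) (Coalgebra.comul (R := ℂ) (gen q x)) * Matrix.diagonal ![u, 1] =
      Matrix.diagonal ![u, 1] * repProj p (repMinus q) (Coalgebra.comul (R := ℂ) (gen q x)) := by
  obtain ⟨ha, hb, hc, hd⟩ := comul_gen q
  cases x <;> ext i j : 2 <;> fin_cases i <;> fin_cases j <;>
    simp [ha, hb, hc, hd, hb', hc', ← hu, projRep_tmul, repProj_tmul, Matrix.mul_diagonal,
      Matrix.diagonal_mul, repMinus, Gen.elim4, mul_comm]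

theorem proj_gen (q : ℝˣ) : proj q (gen q Gen.a) = LaurentPolynomial.T (-1) ∧
    proj q (gen q Gen.b) = 0 ∧ proj q (gen q Gen.c) = 0 ∧
    proj q (gen q Gen.d) = LaurentPolynomial.T 1 :=
  ⟨lift_gen _ _ _ _ _ _, lift_gen _ _ _ _ _ _, lift_gen _ _ _ _ _ _, lift_gen _ _ _ _ _ _⟩

theorem convolve_lamPlus_mem {q : ℝˣ} {k : ℤ} {f : SU q} (hf : f ∈ E q k) :
    convolve (lamPlus q) f ∈ E q (k + 2) := by
  obtain ⟨ha, hb, hc, hd⟩ := proj_gen q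
  refine convolve_mem (repPlus q) 2 (repPlus_intertwine (proj q) _ hb hc ?_) hf
  rw [ha, hd, ← LaurentPolynomial.T_add]
  rfl

theorem convolve_lamMinus_mem {q : ℝˣ} {k : ℤ} {f : SU q} (hf : f ∈ E q k) :
    convolve (lamMinus q) f ∈ E q (k - 2) := by
  obtain ⟨ha, hb, hc, hd⟩ := proj_gen q
  refine convolve_mem (repMinus q) (-2) (repMinus_intertwine (proj q) _ hb hc ?_) hf
  rw [ha, hd, ← LaurentPolynomial.T_add]
  rfl

/-- The operator `X₊ f = f₍₁₎ λ₊(f₍₂₎)` from `ℰ_k` to `ℰ_l`, where `l = k + 2`. -/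
def xPlus (q : ℝˣ) (k l : ℤ) (h : l = k + 2) : E q k →ₗ[ℂ] E q l :=
  (convolve (lamPlus q)).restrict fun _ hf => h ▸ convolve_lamPlus_mem hf

/-- The operator `X₋ f = f₍₁₎ λ₋(f₍₂₎)` from `ℰ_k` to `ℰ_l`, where `l = k - 2`. -/
def xMinus (q : ℝˣ) (k l : ℤ) (h : l = k - 2) : E q k →ₗ[ℂ] E q l :=
  (convolve (lamMinus q)).restrict fun _ hf => h ▸ convolve_lamMinus_mem hf

/-- The space of forms
`Ω^• = Ω^(0,0) ⊕ Ω^(1,0) ⊕ Ω^(0,1) ⊕ Ω^(1,1) = ℰ_0 ⊕ ℰ_2 e⁺ ⊕ ℰ_{-2} e⁻ ⊕ ℰ_0 (e⁺ ∧ e⁻)`: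
the tuple `(f, u, v, w)` stands for `f + u e⁺ + v e⁻ + w e⁺ ∧ e⁻`. -/
abbrev Forms (q : ℝˣ) : Type := E q 0 × E q 2 × E q (-2) × E q 0

/-- The holomorphic differential: `∂ f = X₊(f) e⁺`, `∂ (u e⁺) = 0` and
`∂ (v e⁻) = X₊(v) e⁺ ∧ e⁻`. -/
def del (q : ℝˣ) : Forms q →ₗ[ℂ] Forms q where
  toFun ω := (0, xPlus q 0 2 (by norm_num) ω.1, 0, xPlus q (-2) 0 (by norm_num) ω.2.2.1)
  map_add' := by intro x y; simp
  map_smul' := by intro r x; simp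

/-- The antiholomorphic differential, with `e⁻ ∧ e⁺ = -q² e⁺ ∧ e⁻`: `∂̄ f = X₋(f) e⁻`, `∂̄ (v e⁻) = 0` and
`∂̄ (u e⁺) = X₋(u) e⁻ ∧ e⁺ = -q² X₋(u) e⁺ ∧ e⁻`. -/
def delbar (q : ℝˣ) : Forms q →ₗ[ℂ] Forms q where
  toFun ω := (0, 0, xMinus q 0 (-2) (by norm_num) ω.1,
    -(qc q ^ 2 • xMinus q 2 0 (by norm_num) ω.2.1))
  map_add' := by
    intro x y
    simp only [Prod.fst_add, Prod.snd_add, map_add, smul_add, neg_add, Prod.mk_add_mk, add_zero]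
  map_smul' := by
    intro r x
    simp only [Prod.smul_fst, Prod.smul_snd, map_smul, Prod.smul_mk, smul_zero, smul_neg,
      RingHom.id_apply, smul_comm r]

/-- The exterior derivative `d = ∂ + ∂̄`. -/
def extd (q : ℝˣ) : Forms q →ₗ[ℂ] Forms q := del q + delbar q

/-! ### The metric, adjoints, Laplacians -/

/-- The metric: the sesquilinear map for which the four summands are orthogonal and
`g(f, f') = f f'*`, `g(u e⁺, u' e⁺) = u u'*`, `g(v e⁻, v' e⁻) = q² v v'*`,
`g(w e⁺ ∧ e⁻, w' e⁺ ∧ e⁻) = w w'*`. -/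
def metric (q : ℝˣ) (ω ν : Forms q) : SU q :=
  (ω.1 : SU q) * adj (ν.1 : SU q) + (ω.2.1 : SU q) * adj (ν.2.1 : SU q) +
    (qc q) ^ 2 • ((ω.2.2.1 : SU q) * adj (ν.2.2.1 : SU q)) +
    (ω.2.2.2 : SU q) * adj (ν.2.2.2 : SU q)

/-- The inner product `⟨ω, ν⟩ = h(g(ω, ν))`. -/
def innerProd (q : ℝˣ) (ω ν : Forms q) : ℂ := haar q (metric q ω ν)

/-- `S` is an adjoint of `T` for the inner product. -/
def IsAdjoint {q : ℝˣ} (T S : Forms q →ₗ[ℂ] Forms q) : Prop :=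
  ∀ ω ν : Forms q, innerProd q (T ω) ν = innerProd q ω (S ν)

/-- The anticommutator of two operators. -/
def anti {q : ℝˣ} (S T : Forms q →ₗ[ℂ] Forms q) : Forms q →ₗ[ℂ] Forms q := S ∘ₗ T + T ∘ₗ S

/-- The Dirac operator `D = T + T*` of an operator `T` with adjoint `S = T*`. -/
def dirac {q : ℝˣ} (T S : Forms q →ₗ[ℂ] Forms q) : Forms q →ₗ[ℂ] Forms q := T + S

/-- The Laplacian `D²` of an operator `T` with adjoint `S = T*`. -/
def laplacian {q : ℝˣ} (T S : Forms q →ₗ[ℂ] Forms q) : Forms q →ₗ[ℂ] Forms q :=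
  dirac T S ∘ₗ dirac T S

end Podles
end

noncomputable section

namespace Podles

/-! ### The involution -/

section Adj

variable {q : ℝˣ}

/-! Written in the components of `Forms`, every operator involved is a matrix in `X₊` and `X₋`, and
three facts about these two operators and `h` give everything.

Adjointness. On `ℰ_k` both operators obey a twisted Leibniz rule with weight `q^{-k}`, and `X₊(g*) =
q^l X₋(g)*` for `g` in `ℰ_l`. The invariance `h ∘ X₊ = 0` (`haar_convolve_lamPlus`), applied to `f
g*` with `f` in `ℰ_k` and `g` in `ℰ_{k+2}`, then says that the adjoint of `X₊` is `-q² X₋`.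
Conjugating with `h(f*) = conj h(f)` gives the adjoint of `X₋`. Hence `∂*` and `∂̄*` have the
explicit forms `delAdj` and `delbarAdj`.

Nondegeneracy. Adjoints are unique because `h(f g) = 0` for all `f` forces `g = 0`
(`eq_zero_of_haar_mul`). Pairing with monomials in `b` and `c` yields sums of `c_r / [r + n + 1]`
that vanish for all `n`, with `[m] = 1 + q² + ⋯ + q^(2(m-1))`. These fractions are independent
because, as functions of `[n]`, they have distinct poles. No positivity of `h` is needed.

Commutation. On `ℰ_0` one has `X₊X₋ = q² X₋X₊` (`convolve_comm_zero`). This makes `∂` and `∂̄`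
anticommute, likewise their adjoints, and it gives `(∂,∂*) = (∂̄,∂̄*)`; the mixed anticommutators
vanish by a cancellation of signs. Since `∂`, `∂̄`, `d` and their adjoints all square to zero, each
Laplacian is an anticommutator, and expanding `(∂ + ∂̄, ∂* + ∂̄*)` leaves two equal terms. -/

theorem adj_add (f g : SU q) : adj (f + g) = adj f + adj g := by
  unfold adj; rw [map_add]; rfl

theorem adj_mul (f g : SU q) : adj (f * g) = adj g * adj f := by
  unfold adj; rw [map_mul]; rfl

theorem adj_smul (r : ℂ) (f : SU q) : adj (r • f) = starRingEnd ℂ r • adj f := by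
  unfold adj; rw [map_smul]; rfl

theorem adj_one : adj (1 : SU q) = 1 := by
  unfold adj; rw [map_one]; rfl

theorem adj_zero : adj (0 : SU q) = 0 := by
  simpa using adj_smul (0 : ℂ) (0 : SU q)

theorem adj_neg (f : SU q) : adj (-f) = -adj f := by
  simpa using adj_smul (-1 : ℂ) f

theorem adj_pow (f : SU q) (n : ℕ) : adj (f ^ n) = adj f ^ n := by
  induction n with
  | zero => simp [adj_one]
  | succ n ih => rw [pow_succ, adj_mul, ih, pow_succ']

theorem adj_a : adj (gen q Gen.a) = gen q Gen.d := by
  simp only [adj, starHom, lift_gen, Gen.elim4]; rfl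

theorem adj_b : adj (gen q Gen.b) = (-qc q) • gen q Gen.c := by
  simp only [adj, starHom, lift_gen, Gen.elim4]; rfl

theorem adj_c : adj (gen q Gen.c) = (-(qc q)⁻¹) • gen q Gen.b := by
  simp only [adj, starHom, lift_gen, Gen.elim4]; rfl

theorem adj_d : adj (gen q Gen.d) = gen q Gen.a := by
  simp only [adj, starHom, lift_gen, Gen.elim4]; rfl

@[simp] theorem conj_qc : starRingEnd ℂ (qc q) = qc q := by simp [qc]

theorem adj_adj (f : SU q) : adj (adj f) = f := by
  have hq := qc_ne q
  induction f using induction with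
  | hr r => simp [Algebra.algebraMap_eq_smul_one, adj_smul, adj_one]
  | hg x =>
    cases x <;> simp [adj_a, adj_b, adj_c, adj_d, adj_smul, adj_neg, smul_smul, hq]
  | hm f g hf hg => rw [adj_mul, adj_mul, hf, hg]
  | ha f g hf hg => rw [adj_add, adj_add, hf, hg]

end Adj

/-! ### The grading by the spaces `ℰ_k` -/

section Grading

variable {q : ℝˣ}

theorem one_mem_E : (1 : SU q) ∈ E q 0 := by
  rw [mem_E, map_one, LaurentPolynomial.T_zero]; rfl

theorem mul_mem_E {j k : ℤ} {f g : SU q} (hf : f ∈ E q j) (hg : g ∈ E q k) :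
    f * g ∈ E q (j + k) := by
  rw [mem_E] at *
  rw [map_mul, hf, hg, Algebra.TensorProduct.tmul_mul_tmul, LaurentPolynomial.T_add]

theorem gen_mem_E (q : ℝˣ) : gen q Gen.a ∈ E q (-1) ∧ gen q Gen.b ∈ E q 1 ∧
    gen q Gen.c ∈ E q (-1) ∧ gen q Gen.d ∈ E q 1 := by
  obtain ⟨ha, hb, hc, hd⟩ := comul_gen q
  obtain ⟨pa, pb, pc, pd⟩ := proj_gen q
  refine ⟨?_, ?_, ?_, ?_⟩ <;> rw [mem_E, coact_eq] <;> simp [ha, hb, hc, hd, pa, pb, pc, pd]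

/-- The projection of `ℂ_q[SU₂]` onto `ℰ_k`. -/
def degreeProj (q : ℝˣ) (k : ℤ) : SU q →ₗ[ℂ] SU q :=
  (TensorProduct.rid ℂ (SU q)).toLinearMap ∘ₗ
    LinearMap.lTensor (SU q)
      { toFun := fun p : ℂ[T;T⁻¹] => p.coeff k
        map_add' := fun _ _ => rfl
        map_smul' := fun _ _ => rfl } ∘ₗ (coact q).toLinearMap

theorem degreeProj_of_mem {j : ℤ} (k : ℤ) {f : SU q} (hf : f ∈ E q j) :
    degreeProj q k f = if j = k then f else 0 := by
  rw [mem_E] at hf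
  have hT : (LaurentPolynomial.T j : ℂ[T;T⁻¹]).coeff k = if j = k then 1 else 0 :=
    Finsupp.single_apply
  simp only [degreeProj, LinearMap.comp_apply, AlgHom.toLinearMap_apply, hf]
  rw [LinearMap.lTensor_tmul, LinearEquiv.coe_coe, TensorProduct.rid_tmul]
  change (LaurentPolynomial.T j : ℂ[T;T⁻¹]).coeff k • f = _
  rw [hT, ite_smul, one_smul, zero_smul]

/-- A multiplicative family of subspaces that contains the generators in the right degrees contains
the spaces `ℰ_k`. -/
theorem E_induction (W : ℤ → Submodule ℂ (SU q)) (h1 : (1 : SU q) ∈ W 0)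
    (ha : gen q Gen.a ∈ W (-1)) (hb : gen q Gen.b ∈ W 1)
    (hc : gen q Gen.c ∈ W (-1)) (hd : gen q Gen.d ∈ W 1)
    (hm : ∀ j k f g, f ∈ E q j → g ∈ E q k → f ∈ W j → g ∈ W k → f * g ∈ W (j + k))
    {k : ℤ} {f : SU q} (hf : f ∈ E q k) : f ∈ W k := by
  obtain ⟨Ea, Eb, Ec, Ed⟩ := gen_mem_E q
  -- The sum of the `E q n ⊓ W n` is closed under products and contains the generators, so it is the
  -- whole algebra. `degreeProj` then isolates the degree `k` part of such a decomposition.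
  have key : ∀ f : SU q, f ∈ ⨆ n, (E q n ⊓ W n) := by
    intro f
    induction f using induction with
    | hr r =>
      rw [Algebra.algebraMap_eq_smul_one]
      exact Submodule.smul_mem _ _ (Submodule.mem_iSup_of_mem 0 ⟨one_mem_E, h1⟩)
    | hg x =>
      cases x
      · exact Submodule.mem_iSup_of_mem (-1) ⟨Ea, ha⟩
      · exact Submodule.mem_iSup_of_mem 1 ⟨Eb, hb⟩
      · exact Submodule.mem_iSup_of_mem (-1) ⟨Ec, hc⟩
      · exact Submodule.mem_iSup_of_mem 1 ⟨Ed, hd⟩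
    | hm f g hf hg =>
      have h := Submodule.mul_mem_mul hf hg
      rw [Submodule.iSup_mul] at h
      refine (iSup_le fun j => ?_ : (⨆ j, (E q j ⊓ W j) * ⨆ n, (E q n ⊓ W n)) ≤ _) h
      rw [Submodule.mul_iSup]
      refine iSup_le fun k => Submodule.mul_le.2 fun x hx y hy => ?_
      exact Submodule.mem_iSup_of_mem (j + k)
        ⟨mul_mem_E hx.1 hy.1, hm j k x y hx.1 hy.1 hx.2 hy.2⟩
    | ha f g hf hg => exact add_mem hf hg
  have h2 : (⨆ n, (E q n ⊓ W n)) ≤ (W k).comap (degreeProj q k) := by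
    refine iSup_le fun n x hx => ?_
    rw [Submodule.mem_comap, degreeProj_of_mem k hx.1]
    split_ifs with h
    · exact h ▸ hx.2
    · exact zero_mem _
  have h3 := h2 (key f)
  rwa [Submodule.mem_comap, degreeProj_of_mem k hf, if_pos rfl] at h3

theorem adj_mem_E {k : ℤ} {f : SU q} (hf : f ∈ E q k) : adj f ∈ E q (-k) := by
  obtain ⟨Ea, Eb, Ec, Ed⟩ := gen_mem_E q
  refine E_induction (fun k =>
    { carrier := {f | adj f ∈ E q (-k)}
      add_mem' := fun {f g} hf hg => by
        simp only [Set.mem_ofPred_eq, adj_add] at *; exact add_mem hf hg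
      zero_mem' := by simp only [Set.mem_ofPred_eq, adj_zero]; exact zero_mem _
      smul_mem' := fun r f hf => by
        simp only [Set.mem_ofPred_eq, adj_smul] at *; exact Submodule.smul_mem _ _ hf })
    ?_ ?_ ?_ ?_ ?_ ?_ hf
  · change adj 1 ∈ E q (-0)
    rw [adj_one, neg_zero]; exact one_mem_E
  · change adj _ ∈ E q (- -1)
    rw [adj_a, neg_neg]; exact Ed
  · change adj _ ∈ E q (-1)
    rw [adj_b]; exact Submodule.smul_mem _ _ Ec
  · change adj _ ∈ E q (- -1)
    rw [adj_c, neg_neg]; exact Submodule.smul_mem _ _ Eb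
  · change adj _ ∈ E q (-1)
    rw [adj_d]; exact Ea
  · intro j k f g _ _ hf hg
    change adj _ ∈ E q (-(j + k))
    rw [adj_mul, neg_add_rev]
    exact mul_mem_E hg hf

end Grading

/-! ### The operators `X₊` and `X₋` -/

section Operators

variable {q : ℝˣ}

/-- Multiplicativity of `Δ` turns a product formula for a functional into a product rule for its
convolution operator. -/
theorem convolve_mul {lam al be ga de : SU q →ₗ[ℂ] ℂ}
    (h : ∀ f g, lam (f * g) = al f * be g + ga f * de g) (f g : SU q) :
    convolve lam (f * g) = convolve al f * convolve be g + convolve ga f * convolve de g := by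
  simp only [convolve, LinearMap.comp_apply, LinearEquiv.coe_coe, Bialgebra.comul_mul]
  induction Coalgebra.comul (R := ℂ) f with
  | zero => simp
  | add x y hx hy => simp only [add_mul, map_add, hx, hy]; abel
  | tmul f₁ f₂ =>
    induction Coalgebra.comul (R := ℂ) g with
    | zero => simp
    | add x y hx hy => simp only [mul_add, map_add, hx, hy]; abel
    | tmul g₁ g₂ =>
      simp [h, add_smul, smul_smul, mul_comm]

theorem convolve_counit (f : SU q) :
    convolve (Coalgebra.counit (R := ℂ) (A := SU q)) f = f := by
  simp [convolve]

/-- The character `κ`. -/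
def kappa (q : ℝˣ) : SU q →ₐ[ℂ] ℂ :=
  lift (qc q) 0 0 (qc q)⁻¹ (by have hq := qc_ne q; constructor <;> simp [hq])

theorem convolve_kappa_mul (f g : SU q) :
    convolve (kappa q).toLinearMap (f * g) =
      convolve (kappa q).toLinearMap f * convolve (kappa q).toLinearMap g := by
  have := convolve_mul (lam := (kappa q).toLinearMap) (al := (kappa q).toLinearMap)
    (be := (kappa q).toLinearMap) (ga := 0) (de := 0) (by simp) f g
  simpa [convolve] using this

theorem counit_gen (q : ℝˣ) : Coalgebra.counit (R := ℂ) (gen q Gen.a) = 1 ∧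
    Coalgebra.counit (R := ℂ) (gen q Gen.b) = 0 ∧ Coalgebra.counit (R := ℂ) (gen q Gen.c) = 0 ∧
    Coalgebra.counit (R := ℂ) (gen q Gen.d) = 1 :=
  ⟨lift_gen _ _ _ _ _ _, lift_gen _ _ _ _ _ _, lift_gen _ _ _ _ _ _, lift_gen _ _ _ _ _ _⟩

/-- Upper triangularity with diagonal `(κ, ε)` is multiplicative, so generators suffice. The upper
right entry of such a representation is automatically a `(κ, ε)`-skew derivation. -/
theorem rep_entries (R : SU q →ₐ[ℂ] Matrix (Fin 2) (Fin 2) ℂ)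
    (h : ∀ x, R (gen q x) 0 0 = kappa q (gen q x) ∧ R (gen q x) 1 0 = 0 ∧
      R (gen q x) 1 1 = Coalgebra.counit (R := ℂ) (gen q x)) (f : SU q) :
    R f 0 0 = kappa q f ∧ R f 1 0 = 0 ∧ R f 1 1 = Coalgebra.counit (R := ℂ) f := by
  induction f using induction with
  | hr r => simp [Matrix.algebraMap_eq_diagonal]
  | hg x => exact h x
  | hm f g hf hg => simp [Matrix.mul_apply, Fin.sum_univ_two, hf, hg]
  | ha f g hf hg => simp [hf, hg]

theorem lamPlus_mul (f g : SU q) :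
    lamPlus q (f * g) = kappa q f * lamPlus q g + lamPlus q f * Coalgebra.counit (R := ℂ) g := by
  obtain ⟨ha, hb, hc, hd⟩ := counit_gen q
  have h := rep_entries (repPlus q) (by
    intro x; cases x <;> simp [repPlus, kappa, Gen.elim4, ha, hb, hc, hd])
  simp [lamPlus, Matrix.mul_apply, Fin.sum_univ_two, h]

theorem lamMinus_mul (f g : SU q) :
    lamMinus q (f * g) =
      kappa q f * lamMinus q g + lamMinus q f * Coalgebra.counit (R := ℂ) g := by
  obtain ⟨ha, hb, hc, hd⟩ := counit_gen q
  have h := rep_entries (repMinus q) (by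
    intro x; cases x <;> simp [repMinus, kappa, Gen.elim4, ha, hb, hc, hd])
  simp [lamMinus, Matrix.mul_apply, Fin.sum_univ_two, h]

theorem convolve_one (lam : SU q →ₗ[ℂ] ℂ) : convolve lam (1 : SU q) = lam 1 • 1 := by
  simp [convolve, Algebra.TensorProduct.one_def]

theorem convolve_kappa_gen (q : ℝˣ) :
    convolve (kappa q).toLinearMap (gen q Gen.a) = qc q • gen q Gen.a ∧
    convolve (kappa q).toLinearMap (gen q Gen.b) = (qc q)⁻¹ • gen q Gen.b ∧
    convolve (kappa q).toLinearMap (gen q Gen.c) = qc q • gen q Gen.c ∧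
    convolve (kappa q).toLinearMap (gen q Gen.d) = (qc q)⁻¹ • gen q Gen.d := by
  obtain ⟨ha, hb, hc, hd⟩ := comul_gen q
  simp [convolve, ha, hb, hc, hd, kappa, Gen.elim4]

/-- Conceptually, `κ` is `π` followed by evaluation at `t = q⁻¹`, so it sees only the degree. This
is the source of the weight in the twisted Leibniz rules. -/
theorem convolve_kappa_of_mem {k : ℤ} {f : SU q} (hf : f ∈ E q k) :
    convolve (kappa q).toLinearMap f = qc q ^ (-k) • f := by
  obtain ⟨ha, hb, hc, hd⟩ := convolve_kappa_gen q
  have hq := qc_ne q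
  refine E_induction (fun k => LinearMap.eqLocus (convolve (kappa q).toLinearMap)
    (qc q ^ (-k) • LinearMap.id)) ?_ ?_ ?_ ?_ ?_ ?_ hf
  · simp [LinearMap.mem_eqLocus, convolve_one]
  · simpa [LinearMap.mem_eqLocus] using ha
  · simpa [LinearMap.mem_eqLocus] using hb
  · simpa [LinearMap.mem_eqLocus] using hc
  · simpa [LinearMap.mem_eqLocus] using hd
  · intro j k f g _ _ hf hg
    simp only [LinearMap.mem_eqLocus, LinearMap.smul_apply, LinearMap.id_apply] at *
    rw [convolve_kappa_mul, hf, hg, smul_mul_smul_comm, ← zpow_add₀ hq, neg_add]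

/-- The twisted Leibniz rule for `X₊`. -/
theorem convolve_lamPlus_mul {k : ℤ} {f : SU q} (hf : f ∈ E q k) (g : SU q) :
    convolve (lamPlus q) (f * g) =
      qc q ^ (-k) • (f * convolve (lamPlus q) g) + convolve (lamPlus q) f * g := by
  rw [convolve_mul (al := (kappa q).toLinearMap) (be := lamPlus q) (ga := lamPlus q)
    (de := Coalgebra.counit) (by simpa using lamPlus_mul), convolve_counit,
    convolve_kappa_of_mem hf, smul_mul_assoc]

/-- The twisted Leibniz rule for `X₋`. -/
theorem convolve_lamMinus_mul {k : ℤ} {f : SU q} (hf : f ∈ E q k) (g : SU q) :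
    convolve (lamMinus q) (f * g) =
      qc q ^ (-k) • (f * convolve (lamMinus q) g) + convolve (lamMinus q) f * g := by
  rw [convolve_mul (al := (kappa q).toLinearMap) (be := lamMinus q) (ga := lamMinus q)
    (de := Coalgebra.counit) (by simpa using lamMinus_mul), convolve_counit,
    convolve_kappa_of_mem hf, smul_mul_assoc]

theorem convolve_lamPlus_one : convolve (lamPlus q) 1 = 0 := by
  simp [convolve_one, lamPlus]

theorem convolve_lamMinus_one : convolve (lamMinus q) 1 = 0 := by
  simp [convolve_one, lamMinus]

theorem convolve_lamPlus_gen (q : ℝˣ) :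
    convolve (lamPlus q) (gen q Gen.a) = -(qc q)⁻¹ • gen q Gen.b ∧
    convolve (lamPlus q) (gen q Gen.b) = 0 ∧
    convolve (lamPlus q) (gen q Gen.c) = -(qc q)⁻¹ • gen q Gen.d ∧
    convolve (lamPlus q) (gen q Gen.d) = 0 := by
  obtain ⟨ha, hb, hc, hd⟩ := comul_gen q
  simp [convolve, ha, hb, hc, hd, lamPlus, repPlus, Gen.elim4]

theorem convolve_lamMinus_gen (q : ℝˣ) :
    convolve (lamMinus q) (gen q Gen.a) = 0 ∧
    convolve (lamMinus q) (gen q Gen.b) = (qc q)⁻¹ • gen q Gen.a ∧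
    convolve (lamMinus q) (gen q Gen.c) = 0 ∧
    convolve (lamMinus q) (gen q Gen.d) = (qc q)⁻¹ • gen q Gen.c := by
  obtain ⟨ha, hb, hc, hd⟩ := comul_gen q
  simp [convolve, ha, hb, hc, hd, lamMinus, repMinus, Gen.elim4]

/-- `X₊(g*) = q ^ k X₋(g)*` for `g` of degree `k`. -/
theorem convolve_lamPlus_adj {k : ℤ} {g : SU q} (hg : g ∈ E q k) :
    convolve (lamPlus q) (adj g) = qc q ^ k • adj (convolve (lamMinus q) g) := by
  have hq := qc_ne q
  obtain ⟨pa, pb, pc, pd⟩ := convolve_lamPlus_gen q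
  obtain ⟨ma, mb, mc, md⟩ := convolve_lamMinus_gen q
  refine E_induction (fun k =>
    { carrier := {g | convolve (lamPlus q) (adj g) = qc q ^ k • adj (convolve (lamMinus q) g)}
      add_mem' := fun {f g} hf hg => by
        simp only [Set.mem_ofPred_eq, adj_add, map_add, smul_add] at *; rw [hf, hg]
      zero_mem' := by simp [adj_zero]
      smul_mem' := fun r f hf => by
        simp only [Set.mem_ofPred_eq, adj_smul, map_smul] at *; rw [hf, smul_comm] })
    ?_ ?_ ?_ ?_ ?_ ?_ hg
  · change convolve (lamPlus q) (adj 1) = qc q ^ (0 : ℤ) • adj (convolve (lamMinus q) 1)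
    rw [adj_one, convolve_lamPlus_one, convolve_lamMinus_one, adj_zero, smul_zero]
  · change convolve (lamPlus q) (adj _) = qc q ^ (-1 : ℤ) • adj (convolve (lamMinus q) _)
    simp [adj_a, pd, ma, adj_zero]
  · change convolve (lamPlus q) (adj _) = qc q ^ (1 : ℤ) • adj (convolve (lamMinus q) _)
    simp [adj_a, adj_b, pc, mb, adj_smul, smul_smul, hq]
  · change convolve (lamPlus q) (adj _) = qc q ^ (-1 : ℤ) • adj (convolve (lamMinus q) _)
    simp [adj_c, pb, mc, adj_zero]
  · change convolve (lamPlus q) (adj _) = qc q ^ (1 : ℤ) • adj (convolve (lamMinus q) _)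
    simp [adj_d, pa, md, adj_smul, smul_smul, hq, adj_c]
  · intro j k f g Ef Eg hf hg
    change convolve (lamPlus q) (adj (f * g)) =
      qc q ^ (j + k) • adj (convolve (lamMinus q) (f * g))
    change convolve (lamPlus q) (adj f) = _ at hf
    change convolve (lamPlus q) (adj g) = _ at hg
    -- As `g*` has degree `-k`, both sides become `q^(j+k) g* X₋(f)* + q^k X₋(g)* f*`.
    rw [adj_mul, convolve_lamPlus_mul (adj_mem_E Eg), hf, hg, convolve_lamMinus_mul Ef, adj_add,
      adj_smul, adj_mul, adj_mul, smul_add, smul_smul, map_zpow₀, conj_qc, mul_smul_comm,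
      smul_mul_assoc, smul_smul, ← zpow_add₀ hq, ← zpow_add₀ hq, add_comm]
    congr 3 <;> ring

/-- The scalar by which `X₊ X₋ - q² X₋ X₊` acts in degree `k`. -/
def commScalar (q : ℝˣ) (k : ℤ) : ℂ :=
  if qc q ^ 2 = 1 then -k else (qc q ^ (-2 * k) - 1) / (qc q ^ 2 - 1)

/-- The cocycle identity that lets the commutation relation pass to products. Only degree `0`
matters in the end, where the scalar vanishes, but the generators have degree `±1`, so all degrees
must be followed. -/
theorem commScalar_add (q : ℝˣ) (j k : ℤ) :
    commScalar q (j + k) = qc q ^ (-2 * j) * commScalar q k + commScalar q j := by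
  have hq := qc_ne q
  unfold commScalar
  split_ifs with h
  · have : qc q ^ (-2 * j) = 1 := by
      rw [zpow_mul, zpow_neg]
      norm_cast
      simp [h]
    rw [this]; push_cast; ring
  · have : qc q ^ 2 - 1 ≠ 0 := sub_ne_zero.2 h
    rw [mul_add, zpow_add₀ hq]
    field_simp
    ring

theorem commScalar_zero (q : ℝˣ) : commScalar q 0 = 0 := by simp [commScalar]

theorem commScalar_one (q : ℝˣ) : commScalar q 1 = -(qc q)⁻¹ ^ 2 := by
  have hq := qc_ne q
  unfold commScalar
  split_ifs with h
  · rw [inv_pow, h]; simp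
  · have : qc q ^ 2 - 1 ≠ 0 := sub_ne_zero.2 h
    have h2 : qc q ^ (-2 * 1 : ℤ) = (qc q ^ 2)⁻¹ := by
      rw [mul_one, zpow_neg]; norm_cast
    rw [h2]
    field_simp
    ring

theorem commScalar_neg_one (q : ℝˣ) : commScalar q (-1) = 1 := by
  have hq := qc_ne q
  unfold commScalar
  split_ifs with h
  · simp
  · have : qc q ^ 2 - 1 ≠ 0 := sub_ne_zero.2 h
    have h2 : qc q ^ (-2 * -1 : ℤ) = qc q ^ 2 := by norm_num
    rw [h2]
    field_simp

/-- The commutation relation between `X₊` and `X₋` in degree `k`. -/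
theorem convolve_comm {k : ℤ} {f : SU q} (hf : f ∈ E q k) :
    convolve (lamPlus q) (convolve (lamMinus q) f) =
      qc q ^ 2 • convolve (lamMinus q) (convolve (lamPlus q) f) + commScalar q k • f := by
  have hq := qc_ne q
  obtain ⟨pa, pb, pc, pd⟩ := convolve_lamPlus_gen q
  obtain ⟨ma, mb, mc, md⟩ := convolve_lamMinus_gen q
  refine E_induction (fun k => LinearMap.eqLocus
    (convolve (lamPlus q) ∘ₗ convolve (lamMinus q))
    (qc q ^ 2 • (convolve (lamMinus q) ∘ₗ convolve (lamPlus q)) +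
      commScalar q k • LinearMap.id)) ?_ ?_ ?_ ?_ ?_ ?_ hf
  · simp [LinearMap.mem_eqLocus, convolve_lamPlus_one, convolve_lamMinus_one, commScalar_zero]
  · simp [LinearMap.mem_eqLocus, pa, ma, mb, commScalar_neg_one, smul_smul]
    match_scalars; field_simp; norm_num
  · simp [LinearMap.mem_eqLocus, pb, mb, pa, commScalar_one, smul_smul]
    match_scalars; field_simp
  · simp [LinearMap.mem_eqLocus, pc, mc, md, commScalar_neg_one, smul_smul]
    match_scalars; field_simp; norm_num
  · simp [LinearMap.mem_eqLocus, pd, md, pc, commScalar_one, smul_smul]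
    match_scalars; field_simp
  · intro j k f g Ef Eg hf hg
    simp only [LinearMap.mem_eqLocus, LinearMap.add_apply, LinearMap.smul_apply,
      LinearMap.comp_apply, LinearMap.id_apply] at *
    rw [convolve_lamMinus_mul Ef, convolve_lamPlus_mul Ef, map_add, map_add, map_smul, map_smul,
      convolve_lamPlus_mul Ef, convolve_lamMinus_mul Ef,
      convolve_lamPlus_mul (convolve_lamMinus_mem Ef),
      convolve_lamMinus_mul (convolve_lamPlus_mem Ef), hf, hg, commScalar_add]
    -- The weights at `j ± 2` come from applying Leibniz to `X₋ f` or `X₊ f`. They combine with the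
    -- factor `q²` of the relation so that the mixed terms `X₊f · X₋g` and `X₋f · X₊g` agree on both
    -- sides.
    have e1 : qc q ^ (-(j - 2)) = qc q ^ (-j) * qc q ^ 2 := by
      rw [show -(j - 2) = -j + 2 by ring, zpow_add₀ hq]; norm_cast
    have e2 : qc q ^ (-(j + 2)) = qc q ^ (-j) * (qc q ^ 2)⁻¹ := by
      rw [show -(j + 2) = -j - 2 by ring, zpow_sub₀ hq]; norm_cast
    have e3 : qc q ^ (-2 * j) = qc q ^ (-j) * qc q ^ (-j) := by
      rw [← zpow_add₀ hq]; congr 1; ring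
    rw [e1, e2, e3]
    generalize qc q ^ (-j) = y
    simp only [mul_add, add_mul, smul_add, mul_smul_comm, smul_mul_assoc, smul_smul]
    match_scalars <;> field_simp

end Operators


/-! ### Normally ordered monomials -/

section Monomials

variable {q : ℝˣ}

theorem Relations.b_mul_a_pow {A : Type*} [Ring A] [Algebra ℂ A] {a b c d : A}
    (h : Relations q a b c d) (n : ℕ) : b * a ^ n = (qc q)⁻¹ ^ n • (a ^ n * b) := by
  have hq := qc_ne q
  have h1 : b * a = (qc q)⁻¹ • (a * b) := by rw [h.ab, smul_smul, inv_mul_cancel₀ hq, one_smul]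
  induction n with
  | zero => simp
  | succ n ih =>
    rw [pow_succ, ← mul_assoc, ih, smul_mul_assoc, mul_assoc, h1, mul_smul_comm, smul_smul,
      mul_assoc, pow_succ]

theorem Relations.c_mul_a_pow {A : Type*} [Ring A] [Algebra ℂ A] {a b c d : A}
    (h : Relations q a b c d) (n : ℕ) : c * a ^ n = (qc q)⁻¹ ^ n • (a ^ n * c) := by
  have hq := qc_ne q
  have h1 : c * a = (qc q)⁻¹ • (a * c) := by rw [h.ac, smul_smul, inv_mul_cancel₀ hq, one_smul]
  induction n with
  | zero => simp
  | succ n ih =>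
    rw [pow_succ, ← mul_assoc, ih, smul_mul_assoc, mul_assoc, h1, mul_smul_comm, smul_smul,
      mul_assoc, pow_succ]

theorem Relations.b_mul_d_pow {A : Type*} [Ring A] [Algebra ℂ A] {a b c d : A}
    (h : Relations q a b c d) (n : ℕ) : b * d ^ n = qc q ^ n • (d ^ n * b) := by
  induction n with
  | zero => simp
  | succ n ih =>
    rw [pow_succ, ← mul_assoc, ih, smul_mul_assoc, mul_assoc, h.bd, mul_smul_comm, smul_smul,
      mul_assoc, pow_succ]

theorem Relations.c_mul_d_pow {A : Type*} [Ring A] [Algebra ℂ A] {a b c d : A}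
    (h : Relations q a b c d) (n : ℕ) : c * d ^ n = qc q ^ n • (d ^ n * c) := by
  induction n with
  | zero => simp
  | succ n ih =>
    rw [pow_succ, ← mul_assoc, ih, smul_mul_assoc, mul_assoc, h.cd, mul_smul_comm, smul_smul,
      mul_assoc, pow_succ]

/-- The normally ordered monomial with exponents `(i, j, k)`. -/
def monomial (q : ℝˣ) (i : ℤ) (j k : ℕ) : SU q :=
  gen q Gen.a ^ i.toNat * gen q Gen.d ^ (-i).toNat * (gen q Gen.b ^ j * gen q Gen.c ^ k)

theorem monomial_natCast (n j k : ℕ) :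
    monomial q n j k = gen q Gen.a ^ n * (gen q Gen.b ^ j * gen q Gen.c ^ k) := by
  simp [monomial]

theorem monomial_neg_natCast (n j k : ℕ) :
    monomial q (-n) j k = gen q Gen.d ^ n * (gen q Gen.b ^ j * gen q Gen.c ^ k) := by
  simp [monomial]

theorem b_c_pow (j k : ℕ) : gen q Gen.b * (gen q Gen.b ^ j * gen q Gen.c ^ k) =
    gen q Gen.b ^ (j + 1) * gen q Gen.c ^ k := by
  rw [← mul_assoc, ← pow_succ']

theorem c_b_pow (j k : ℕ) : gen q Gen.c * (gen q Gen.b ^ j * gen q Gen.c ^ k) =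
    gen q Gen.b ^ j * gen q Gen.c ^ (k + 1) := by
  have h : Commute (gen q Gen.b) (gen q Gen.c) := (gen_relations q).bc
  rw [← mul_assoc, ← (h.pow_left j).eq, mul_assoc, ← pow_succ']

theorem b_mul_monomial (i : ℤ) (j k : ℕ) :
    gen q Gen.b * monomial q i j k = qc q ^ (-i) • monomial q i (j + 1) k := by
  have h := gen_relations q
  obtain ⟨n, rfl | rfl⟩ := i.eq_nat_or_neg
  · rw [monomial_natCast, monomial_natCast, ← mul_assoc, h.b_mul_a_pow, smul_mul_assoc, mul_assoc,
      b_c_pow]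
    simp
  · rw [monomial_neg_natCast, monomial_neg_natCast, ← mul_assoc, h.b_mul_d_pow, smul_mul_assoc,
      mul_assoc, b_c_pow]
    simp

theorem c_mul_monomial (i : ℤ) (j k : ℕ) :
    gen q Gen.c * monomial q i j k = qc q ^ (-i) • monomial q i j (k + 1) := by
  have h := gen_relations q
  obtain ⟨n, rfl | rfl⟩ := i.eq_nat_or_neg
  · rw [monomial_natCast, monomial_natCast, ← mul_assoc, h.c_mul_a_pow, smul_mul_assoc, mul_assoc,
      c_b_pow]
    simp
  · rw [monomial_neg_natCast, monomial_neg_natCast, ← mul_assoc, h.c_mul_d_pow, smul_mul_assoc,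
      mul_assoc, c_b_pow]
    simp

theorem a_mul_monomial_of_nonneg {i : ℤ} (hi : 0 ≤ i) (j k : ℕ) :
    gen q Gen.a * monomial q i j k = monomial q (i + 1) j k := by
  lift i to ℕ using hi
  have := monomial_natCast (q := q) (i + 1) j k
  push_cast at this
  rw [monomial_natCast, this, ← mul_assoc, ← pow_succ']

theorem d_mul_monomial_of_nonpos {i : ℤ} (hi : i ≤ 0) (j k : ℕ) :
    gen q Gen.d * monomial q i j k = monomial q (i - 1) j k := by
  obtain ⟨n, rfl⟩ := Int.exists_eq_neg_ofNat hi
  have := monomial_neg_natCast (q := q) (n + 1) j k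
  push_cast at this
  rw [monomial_neg_natCast, show (-(n : ℤ) - 1) = -(n + 1) by ring, this, ← mul_assoc, ← pow_succ']

/-- Split off one `d`, apply `ad = 1 + q bc`, and move `b` and `c` past the remaining powers of `d`.
The coefficient is the one built into `mulA`. -/
theorem a_mul_monomial_of_neg {i : ℤ} (hi : i < 0) (j k : ℕ) :
    gen q Gen.a * monomial q i j k = monomial q (i + 1) j k +
      qc q ^ (-2 * i - 1) • monomial q (i + 1) (j + 1) (k + 1) := by
  have hq := qc_ne q
  have h := gen_relations q
  have h1 : monomial q i j k = gen q Gen.d * monomial q (i + 1) j k := by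
    rw [d_mul_monomial_of_nonpos (by omega), add_sub_cancel_right]
  rw [h1, ← mul_assoc, h.ad, add_mul, one_mul, smul_mul_assoc, mul_assoc, c_mul_monomial,
    mul_smul_comm, b_mul_monomial, smul_smul, smul_smul]
  congr 2
  rw [← zpow_one_add₀ hq, ← zpow_add₀ hq]
  congr 1; ring

theorem d_mul_monomial_of_pos {i : ℤ} (hi : 0 < i) (j k : ℕ) :
    gen q Gen.d * monomial q i j k = monomial q (i - 1) j k +
      qc q ^ (1 - 2 * i) • monomial q (i - 1) (j + 1) (k + 1) := by
  have hq := qc_ne q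
  have h := gen_relations q
  have h1 : monomial q i j k = gen q Gen.a * monomial q (i - 1) j k := by
    rw [a_mul_monomial_of_nonneg (by omega), sub_add_cancel]
  rw [h1, ← mul_assoc, h.da, add_mul, one_mul, smul_mul_assoc, mul_assoc, c_mul_monomial,
    mul_smul_comm, b_mul_monomial, smul_smul, smul_smul]
  congr 2
  rw [← zpow_neg_one, ← zpow_add₀ hq, ← zpow_add₀ hq]
  congr 1; ring

/-- The element of `ℂ_q[SU₂]` with given coordinates. -/
def ofCoords (q : ℝˣ) : PBW →ₗ[ℂ] SU q :=
  Finsupp.linearCombination ℂ fun m => monomial q m.1 m.2.1 m.2.2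

theorem ofCoords_single (i : ℤ) (j k : ℕ) (x : ℂ) :
    ofCoords q (Finsupp.single (i, j, k) x) = x • monomial q i j k := by
  simp [ofCoords]

/-- The multiplication tables on `PBW` were modelled on left multiplication of monomials; checking
this on generators makes `ofCoords` a module map. -/
theorem ofCoords_pbwRep (f : SU q) (v : PBW) :
    ofCoords q (pbwRep q f v) = f * ofCoords q v := by
  have h1 : ∀ (T : PBW →ₗ[ℂ] PBW) (x : SU q),
      (∀ i j k, ofCoords q (T (Finsupp.single (i, j, k) 1)) = x * monomial q i j k) →
      ∀ v, ofCoords q (T v) = x * ofCoords q v := by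
    intro T x hT
    refine LinearMap.congr_fun (f := ofCoords q ∘ₗ T)
      (g := LinearMap.mulLeft ℂ x ∘ₗ ofCoords q) ?_
    refine Finsupp.lhom_ext' fun ⟨i, j, k⟩ => LinearMap.ext_ring ?_
    simp [hT, ofCoords_single]
  induction f using induction generalizing v with
  | hr r => simp [Algebra.algebraMap_eq_smul_one]
  | hg x =>
    cases x <;> simp only [pbwRep, lift_gen, Gen.elim4] <;> refine h1 _ _ (fun i j k => ?_) v
    · rw [mulA_single]
      split_ifs with hi
      · rw [ofCoords_single, one_smul, a_mul_monomial_of_nonneg hi]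
      · rw [map_add, ofCoords_single, ofCoords_single, one_smul, one_mul,
          a_mul_monomial_of_neg (by omega)]
    · rw [mulB_single, ofCoords_single, one_mul, b_mul_monomial]
    · rw [mulC_single, ofCoords_single, one_mul, c_mul_monomial]
    · rw [mulD_single]
      split_ifs with hi
      · rw [ofCoords_single, one_smul, d_mul_monomial_of_nonpos hi]
      · rw [map_add, ofCoords_single, ofCoords_single, one_smul, one_mul,
          d_mul_monomial_of_pos (by omega)]
  | hm f g hf hg => rw [map_mul, Module.End.mul_apply, hf, hg, mul_assoc]
  | ha f g hf hg => rw [map_add, LinearMap.add_apply, map_add, hf, hg, add_mul]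

theorem normalForm_mul (f g : SU q) : normalForm q (f * g) = pbwRep q f (normalForm q g) := by
  simp [normalForm]

/-- The spanning half of the monomial basis theorem; `normalForm_monomial` is the independence half.
-/
theorem ofCoords_normalForm (f : SU q) : ofCoords q (normalForm q f) = f := by
  change ofCoords q (pbwRep q f (Finsupp.single (0, 0, 0) 1)) = f
  rw [ofCoords_pbwRep, ofCoords_single]
  simp [monomial]

/-- Linear maps that agree on normally ordered monomials agree. -/
theorem forall_of_monomial {V : Type*} [AddCommGroup V] [Module ℂ V] {S T : SU q →ₗ[ℂ] V}
    (h : ∀ i j k, S (monomial q i j k) = T (monomial q i j k)) (f : SU q) : S f = T f := by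
  have : S ∘ₗ ofCoords q = T ∘ₗ ofCoords q := by
    refine Finsupp.lhom_ext' fun ⟨i, j, k⟩ => LinearMap.ext_ring ?_
    simp [ofCoords_single, h]
  rw [← ofCoords_normalForm f]
  exact LinearMap.congr_fun this _

theorem pbwRep_gen (q : ℝˣ) : pbwRep q (gen q Gen.a) = mulA q ∧
    pbwRep q (gen q Gen.b) = mulB q ∧ pbwRep q (gen q Gen.c) = mulC q ∧
    pbwRep q (gen q Gen.d) = mulD q :=
  ⟨lift_gen _ _ _ _ _ _, lift_gen _ _ _ _ _ _, lift_gen _ _ _ _ _ _, lift_gen _ _ _ _ _ _⟩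

theorem normalForm_monomial (i : ℤ) (j k : ℕ) :
    normalForm q (monomial q i j k) = Finsupp.single (i, j, k) 1 := by
  obtain ⟨ha, hb, hc, hd⟩ := pbwRep_gen q
  have h0 : normalForm q (gen q Gen.b ^ j * gen q Gen.c ^ k) = Finsupp.single (0, j, k) 1 := by
    induction j with
    | zero =>
      rw [pow_zero, one_mul]
      induction k with
      | zero => simp [normalForm]
      | succ k ih => rw [pow_succ', normalForm_mul, ih, hc, mulC_single]; simp
    | succ j ih => rw [pow_succ', mul_assoc, normalForm_mul, ih, hb, mulB_single]; simp
  obtain ⟨n, rfl | rfl⟩ := i.eq_nat_or_neg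
  · rw [monomial_natCast]
    induction n with
    | zero => simpa using h0
    | succ n ih =>
      rw [pow_succ', mul_assoc, normalForm_mul, ih, ha, mulA_single, if_pos (by omega)]
      push_cast; rfl
  · rw [monomial_neg_natCast]
    induction n with
    | zero => simpa using h0
    | succ n ih =>
      rw [pow_succ', mul_assoc, normalForm_mul, ih, hd, mulD_single, if_pos (by omega)]
      push_cast; congr 2; ring

/-- The `q²`-integer `1 + q² + ⋯ + q ^ (2 (n - 1))`. -/
def qInt (q : ℝˣ) (n : ℕ) : ℂ := ∑ r ∈ Finset.range n, qc q ^ (2 * r)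

theorem qInt_eq_ofReal (n : ℕ) :
    qInt q n = ((∑ r ∈ Finset.range n, (q : ℝ) ^ (2 * r) : ℝ) : ℂ) := by
  simp [qInt, qc]

/-- A nonempty sum of even powers of a nonzero real number is positive. -/
theorem qInt_succ_ne (n : ℕ) : qInt q (n + 1) ≠ 0 := by
  rw [qInt_eq_ofReal, Complex.ofReal_ne_zero]
  refine ne_of_gt (Finset.sum_pos (fun r _ => ?_) (by simp))
  rw [pow_mul]
  have := q.ne_zero
  positivity

theorem qInt_succ (n : ℕ) : qInt q (n + 1) = 1 + qc q ^ 2 * qInt q n := by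
  rw [qInt, Finset.sum_range_succ', qInt, Finset.mul_sum, add_comm]
  simp [mul_add, pow_add, mul_comm (qc q ^ 2)]

/-- The Haar functional in coordinates. -/
def haarCoords (q : ℝˣ) : PBW →ₗ[ℂ] ℂ :=
  Finsupp.linearCombination ℂ fun m : ℤ × ℕ × ℕ =>
    if m.1 = 0 ∧ m.2.1 = m.2.2 then (-qc q) ^ m.2.1 / qInt q (m.2.1 + 1) else 0

theorem haar_eq (f : SU q) : haar q f = haarCoords q (normalForm q f) := rfl

theorem haar_monomial (i : ℤ) (j k : ℕ) : haar q (monomial q i j k) =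
    if i = 0 ∧ j = k then (-qc q) ^ j / qInt q (j + 1) else 0 := by
  rw [haar_eq, normalForm_monomial]
  simp [haarCoords]

end Monomials


/-! ### Invariance and nondegeneracy of the Haar functional -/

section Haar

variable {q : ℝˣ}

theorem pow_mem_E {k : ℤ} {f : SU q} (hf : f ∈ E q k) (n : ℕ) : f ^ n ∈ E q (n * k) := by
  induction n with
  | zero => simpa using one_mem_E
  | succ n ih =>
    rw [pow_succ]
    convert mul_mem_E ih hf using 2
    push_cast; ring

theorem monomial_mem_E (i : ℤ) (j k : ℕ) : monomial q i j k ∈ E q (-i + j - k) := by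
  obtain ⟨Ea, Eb, Ec, Ed⟩ := gen_mem_E q
  have := mul_mem_E (mul_mem_E (pow_mem_E Ea i.toNat) (pow_mem_E Ed (-i).toNat))
    (mul_mem_E (pow_mem_E Eb j) (pow_mem_E Ec k))
  unfold monomial
  convert this using 2
  omega

/-- The monomials on which `h` is nonzero all have degree `0`, so `h` factors through the projection
onto `ℰ_0`. -/
theorem haar_eq_zero_of_mem {k : ℤ} (hk : k ≠ 0) {f : SU q} (hf : f ∈ E q k) :
    haar q f = 0 := by
  have h := forall_of_monomial (S := haar q) (T := haar q ∘ₗ degreeProj q 0) (by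
    intro i j k
    rw [LinearMap.comp_apply, degreeProj_of_mem 0 (monomial_mem_E i j k)]
    split_ifs with h
    · rfl
    · rw [map_zero, haar_monomial, if_neg (by omega)]) f
  rw [h, LinearMap.comp_apply, degreeProj_of_mem 0 hf, if_neg hk, map_zero]

/-- Applied to `x = b` and `x = d`, which `X₊` annihilates. -/
theorem convolve_lamPlus_pow_mul {x : SU q} {k : ℤ} (hx : x ∈ E q k)
    (h0 : convolve (lamPlus q) x = 0) (n : ℕ) (g : SU q) :
    convolve (lamPlus q) (x ^ n * g) =
      (qc q ^ (-k)) ^ n • (x ^ n * convolve (lamPlus q) g) := by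
  induction n with
  | zero => simp
  | succ n ih =>
    rw [pow_succ', mul_assoc, convolve_lamPlus_mul hx, ih, h0, zero_mul, add_zero, mul_smul_comm,
      smul_smul, pow_succ', mul_assoc]

/-- For `k = 0` the truncated exponent `k - 1` is harmless because the coefficient `qInt q 0` is
zero. -/
theorem convolve_lamPlus_c_pow (k : ℕ) : convolve (lamPlus q) (gen q Gen.c ^ k) =
    (-(qc q)⁻¹ * qInt q k) • (gen q Gen.d * gen q Gen.c ^ (k - 1)) := by
  have hq := qc_ne q
  obtain ⟨_, _, Ec, _⟩ := gen_mem_E q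
  obtain ⟨_, _, pc, _⟩ := convolve_lamPlus_gen q
  induction k with
  | zero => simp [convolve_lamPlus_one, qInt]
  | succ k ih =>
    rw [pow_succ', convolve_lamPlus_mul Ec, ih, pc, qInt_succ, Nat.add_sub_cancel]
    rcases k with _ | k
    · simp [qInt]
    · rw [Nat.add_sub_cancel, mul_smul_comm, ← mul_assoc, (gen_relations q).cd, smul_mul_assoc,
        mul_assoc, ← pow_succ', smul_mul_assoc, neg_neg, zpow_one, smul_smul, smul_smul, ← add_smul]
      congr 1
      field_simp
      ring

theorem convolve_lamPlus_monomial_zero (j k : ℕ) : convolve (lamPlus q) (monomial q 0 j k) =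
    (-(qc q)⁻¹ * qInt q k) • monomial q (-1) j (k - 1) := by
  have hq := qc_ne q
  obtain ⟨_, Eb, _, _⟩ := gen_mem_E q
  obtain ⟨_, pb, _, _⟩ := convolve_lamPlus_gen q
  have h1 : gen q Gen.b ^ j * gen q Gen.d = qc q ^ j • (gen q Gen.d * gen q Gen.b ^ j) := by
    induction j with
    | zero => simp
    | succ j ih =>
      rw [pow_succ', mul_assoc, ih, mul_smul_comm, ← mul_assoc, (gen_relations q).bd,
        smul_mul_assoc, smul_smul, mul_assoc, pow_succ]
  have h2 := monomial_natCast (q := q) 0 j k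
  have h3 := monomial_neg_natCast (q := q) 1 j (k - 1)
  rw [Nat.cast_zero, pow_zero, one_mul] at h2
  rw [Nat.cast_one, pow_one] at h3
  rw [h2, h3, convolve_lamPlus_pow_mul Eb pb, convolve_lamPlus_c_pow, mul_smul_comm, ← mul_assoc,
    h1, smul_mul_assoc, smul_smul, smul_smul, mul_assoc (gen q Gen.d)]
  congr 1
  rw [zpow_neg_one, inv_pow]
  field_simp

theorem convolve_lamPlus_a_pow (n : ℕ) : ∃ x : ℂ, convolve (lamPlus q) (gen q Gen.a ^ (n + 1)) =
    x • (gen q Gen.a ^ n * gen q Gen.b) := by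
  obtain ⟨Ea, _, _, _⟩ := gen_mem_E q
  obtain ⟨pa, _, _, _⟩ := convolve_lamPlus_gen q
  induction n with
  | zero => exact ⟨-(qc q)⁻¹, by simp [pa]⟩
  | succ n ih =>
    obtain ⟨x, hx⟩ := ih
    rw [pow_succ', convolve_lamPlus_mul Ea, hx, pa, smul_mul_assoc,
      (gen_relations q).b_mul_a_pow, mul_smul_comm, ← mul_assoc, ← pow_succ', smul_smul, smul_smul,
      ← add_smul]
    exact ⟨_, rfl⟩

/-- On monomials, the value can fail to vanish termwise only for `a b^j c^(j+1)`. There the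
contributions of `(bc)^j` and `(bc)^(j+1)` cancel because `[j+2] = 1 + q² [j+1]`. -/
theorem haar_convolve_lamPlus (f : SU q) : haar q (convolve (lamPlus q) f) = 0 := by
  have hq := qc_ne q
  obtain ⟨Ea, _, _, Ed⟩ := gen_mem_E q
  obtain ⟨pa, _, _, pd⟩ := convolve_lamPlus_gen q
  refine forall_of_monomial (S := haar q ∘ₗ convolve (lamPlus q)) (T := 0) (fun i j k => ?_) f
  rw [LinearMap.comp_apply, LinearMap.zero_apply]
  have hz : monomial q 0 j k = gen q Gen.b ^ j * gen q Gen.c ^ k := by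
    simpa using monomial_natCast (q := q) 0 j k
  obtain ⟨n, rfl | rfl⟩ := i.eq_nat_or_neg
  · rcases n with _ | n
    · rw [Nat.cast_zero, convolve_lamPlus_monomial_zero, map_smul, haar_monomial,
        if_neg (by omega), smul_zero]
    · have e1 : gen q Gen.a ^ (n + 1) * monomial q (-1) j (k - 1) =
          monomial q n j (k - 1) + qc q • monomial q n (j + 1) (k - 1 + 1) := by
        rw [pow_succ, mul_assoc, a_mul_monomial_of_neg (by omega), mul_add, mul_smul_comm]
        simp only [monomial_natCast, neg_add_cancel]
        have h2 := monomial_natCast (q := q) 0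
        simp only [Nat.cast_zero, pow_zero, one_mul] at h2
        rw [h2, h2]
        norm_num
      obtain ⟨x, hx⟩ := convolve_lamPlus_a_pow (q := q) n
      have e2 : convolve (lamPlus q) (monomial q (n + 1 : ℕ) j k) =
          (qc q ^ (n + 1) * (-(qc q)⁻¹ * qInt q k)) •
            (monomial q n j (k - 1) + qc q • monomial q n (j + 1) (k - 1 + 1)) +
          x • monomial q n (j + 1) k := by
        rw [monomial_natCast, convolve_lamPlus_mul (pow_mem_E Ea (n + 1)), hx, ← hz,
          convolve_lamPlus_monomial_zero, mul_smul_comm, e1, smul_smul, hz, smul_mul_assoc,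
          mul_assoc, b_c_pow, ← monomial_natCast]
        congr 3
        simp only [mul_neg_one, neg_neg]
        norm_cast
      rw [e2]
      simp only [map_add, map_smul, haar_monomial, smul_eq_mul]
      by_cases hn : n = 0
      · subst hn
        -- `convolve_lamPlus_a_pow` leaves its scalar unspecified; its value is needed only here and
        -- is read off as the coordinate of `b`.
        have hx' : x = -(qc q)⁻¹ := by
          have h4 := congrArg (normalForm q) hx
          have h5 := normalForm_monomial (q := q) 0 1 0
          rw [monomial] at h5
          simp only [Int.toNat_zero, neg_zero, pow_zero, mul_one, one_mul, pow_one] at h5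
          rw [zero_add, pow_one, pow_zero, one_mul, pa, map_smul, map_smul, h5] at h4
          have := DFunLike.congr_fun h4 (0, 1, 0)
          simpa using this.symm
        rcases k with _ | k
        · simp [qInt]
        · by_cases hjk : j = k
          · subst hjk
            have n1 := qInt_succ_ne (q := q) j
            have n2 := qInt_succ_ne (q := q) (j + 1)
            simp only [Nat.cast_zero, Nat.add_sub_cancel, and_self, if_true, hx']
            field_simp
            rw [qInt_succ (j + 1)]
            ring
          · simp [hjk]
      · simp [hn]
  · rw [monomial_neg_natCast, convolve_lamPlus_pow_mul Ed pd, ← hz, convolve_lamPlus_monomial_zero,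
      mul_smul_comm, map_smul, map_smul]
    have : gen q Gen.d ^ n * monomial q (-1) j (k - 1) =
        monomial q (-(n + 1 : ℕ)) j (k - 1) := by
      rw [monomial_neg_natCast, pow_succ, mul_assoc]
      congr 1
      simpa using monomial_neg_natCast (q := q) 1 j (k - 1)
    rw [this, haar_monomial, if_neg (by omega)]
    simp

/-- The involution sends the monomial `(i, j, k)` to a multiple of `(-i, k, j)`. On powers of `bc`
this multiple is `1`, and the values of `h` there are real. -/
theorem haar_adj (f : SU q) : haar q (adj f) = starRingEnd ℂ (haar q f) := by
  have hq := qc_ne q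
  have hc : ∀ i : ℤ, ∀ j : ℕ, gen q Gen.c ^ j * monomial q i 0 0 =
      (qc q ^ (-i)) ^ j • monomial q i 0 j := by
    intro i j
    induction j with
    | zero => simp
    | succ j ih =>
      rw [pow_succ', mul_assoc, ih, mul_smul_comm, c_mul_monomial, smul_smul, pow_succ]
  have hb : ∀ i : ℤ, ∀ j k : ℕ, gen q Gen.b ^ k * monomial q i 0 j =
      (qc q ^ (-i)) ^ k • monomial q i k j := by
    intro i j k
    induction k with
    | zero => simp
    | succ k ih =>
      rw [pow_succ', mul_assoc, ih, mul_smul_comm, b_mul_monomial, smul_smul, pow_succ]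
  -- The conjugate is placed on `h(f*)`, so that both sides are complex linear in `f` and monomials
  -- suffice.
  have key := forall_of_monomial (S := haar q)
    (T := { toFun := fun f => starRingEnd ℂ (haar q (adj f))
            map_add' := fun f g => by rw [adj_add, map_add, map_add]
            map_smul' := fun r f => by
              rw [adj_smul, map_smul, smul_eq_mul, map_mul]; simp }) (by
      intro i j k
      change _ = starRingEnd ℂ (haar q (adj (monomial q i j k)))
      have e1 : adj (monomial q i j k) =
          ((-(qc q)⁻¹) ^ k * (-qc q) ^ j * (qc q ^ i) ^ j * (qc q ^ i) ^ k) •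
            monomial q (-i) k j := by
        have e0 : adj (gen q Gen.a ^ i.toNat * gen q Gen.d ^ (-i).toNat) =
            monomial q (-i) 0 0 := by
          rw [adj_mul, adj_pow, adj_pow, adj_a, adj_d]
          simp [monomial]
        rw [monomial, adj_mul, e0, adj_mul, adj_pow, adj_pow, adj_b, adj_c, smul_pow, smul_pow,
          smul_mul_smul_comm, smul_mul_assoc, mul_assoc, hc, mul_smul_comm, hb, smul_smul,
          smul_smul, neg_neg, mul_assoc, mul_assoc]
      rw [e1, map_smul, haar_monomial, haar_monomial]
      by_cases h : i = 0 ∧ j = k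
      · obtain ⟨rfl, rfl⟩ := h
        have hc' : starRingEnd ℂ (qInt q (j + 1)) = qInt q (j + 1) := by
          rw [qInt_eq_ofReal, Complex.conj_ofReal]
        simp [hc', ← mul_pow, hq]
      · rw [if_neg h, if_neg (by omega)]
        simp) f
  rw [key]
  exact (Complex.conj_conj _).symm

end Haar


/-! ### Nondegeneracy by partial fractions in the `q²`-integers -/

section Nondegenerate

variable {q : ℝˣ}

/-- The functions `y ↦ (α r + β r y)⁻¹` with distinct poles are linearly independent on every
infinite set. -/
theorem eq_zero_of_sum_div {S : Finset ℕ} {c α β : ℕ → ℂ} {y : ℕ → ℂ} (hy : Function.Injective y)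
    (hne : ∀ r n, α r + β r * y n ≠ 0) (hβ : ∀ r, β r ≠ 0)
    (hinj : ∀ r s, α r * β s = α s * β r → r = s)
    (h : ∀ n, ∑ r ∈ S, c r / (α r + β r * y n) = 0) {r : ℕ} (hr : r ∈ S) : c r = 0 := by
  classical
  -- The numerator after clearing denominators. It vanishes at every `y n`, hence identically, and
  -- its value at the pole of the `r`-th fraction is `c r` times a nonzero product.
  set P : Polynomial ℂ := ∑ r ∈ S, Polynomial.C (c r) *
    ∏ s ∈ S.erase r, (Polynomial.C (α s) + Polynomial.C (β s) * Polynomial.X) with hP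
  have hev : ∀ z, P.eval z = ∑ r ∈ S, c r * ∏ s ∈ S.erase r, (α s + β s * z) := by
    intro z
    simp [hP, Polynomial.eval_finsetSum, Polynomial.eval_prod]
  have h0 : P = 0 := by
    refine Polynomial.eq_zero_of_infinite_isRoot P
      ((Set.infinite_range_of_injective hy).mono ?_)
    rintro _ ⟨n, rfl⟩
    change P.eval (y n) = 0
    rw [hev]
    have : (∏ s ∈ S, (α s + β s * y n)) * ∑ r ∈ S, c r / (α r + β r * y n) = 0 := by
      rw [h, mul_zero]
    rw [← this, Finset.mul_sum]
    refine Finset.sum_congr rfl fun r hr => ?_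
    rw [← Finset.mul_prod_erase S _ hr]
    have hA := hne r n
    generalize α r + β r * y n = A at hA ⊢
    generalize ∏ s ∈ S.erase r, (α s + β s * y n) = B
    field_simp
  have h1 := hev (-α r / β r)
  rw [h0, Polynomial.eval_zero, Finset.sum_eq_single r] at h1
  · rcases mul_eq_zero.1 h1.symm with h2 | h2
    · exact h2
    · rw [Finset.prod_eq_zero_iff] at h2
      obtain ⟨s, hs, h3⟩ := h2
      refine absurd (hinj r s ?_) (Finset.ne_of_mem_erase hs).symm
      have := hβ r
      field_simp at h3
      linear_combination -h3
  · intro s _ hs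
    rw [Finset.prod_eq_zero (i := r) (Finset.mem_erase.2 ⟨hs.symm, hr⟩), mul_zero]
    have := hβ r
    field_simp
    ring
  · exact fun h => absurd hr h

theorem qInt_add (m n : ℕ) : qInt q (m + n) = qInt q m + qc q ^ (2 * m) * qInt q n := by
  simp only [qInt, Finset.sum_range_add, Finset.mul_sum, mul_add, pow_add]

theorem qInt_eq_zero {n : ℕ} (h : qInt q n = 0) : n = 0 := by
  rcases n with _ | n
  · rfl
  · exact absurd h (qInt_succ_ne n)

theorem qInt_injective (q : ℝˣ) : Function.Injective (qInt q) := by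
  have hq := qc_ne q
  have key : ∀ m n, m ≤ n → qInt q m = qInt q n → m = n := by
    intro m n hmn h
    obtain ⟨d, rfl⟩ := Nat.exists_eq_add_of_le hmn
    rw [qInt_add] at h
    have h1 : qc q ^ (2 * m) * qInt q d = 0 := by linear_combination -h
    have := qInt_eq_zero ((mul_eq_zero.1 h1).resolve_left (pow_ne_zero _ hq))
    omega
  intro m n h
  rcases le_total m n with hmn | hmn
  · exact key m n hmn h
  · exact (key n m hmn h.symm).symm

/-- Since `[r+n+1] = [r+1] + q^(2(r+1)) [n]`, each denominator is affine in `[n]`, which takes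
infinitely many values. -/
theorem eq_zero_of_sum_div_qInt {S : Finset ℕ} {c : ℕ → ℂ}
    (h : ∀ n, ∑ r ∈ S, c r / qInt q (r + n + 1) = 0) {r : ℕ} (hr : r ∈ S) : c r = 0 := by
  have hq := qc_ne q
  have e : ∀ r n, qInt q (r + n + 1) = qInt q (r + 1) + qc q ^ (2 * (r + 1)) * qInt q n := by
    intro r n
    rw [← qInt_add]; congr 1; omega
  refine eq_zero_of_sum_div (S := S) (α := fun r => qInt q (r + 1))
    (β := fun r => qc q ^ (2 * (r + 1))) (y := qInt q) (qInt_injective q) (fun r n => ?_)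
    (fun r => pow_ne_zero _ hq) ?_ (fun n => ?_) hr
  · rw [← e]; exact qInt_succ_ne _
  · have key : ∀ m n, m ≤ n → qInt q (m + 1) * qc q ^ (2 * (n + 1)) =
        qInt q (n + 1) * qc q ^ (2 * (m + 1)) → m = n := by
      intro m n hmn h
      obtain ⟨d, rfl⟩ := Nat.exists_eq_add_of_le hmn
      have e2 := qInt_add (q := q) d (m + 1)
      rw [show m + d + 1 = d + (m + 1) by ring, e2, mul_add 2 d, pow_add] at h
      have h1 : qInt q d * qc q ^ (2 * (m + 1)) = 0 := by linear_combination -h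
      have := qInt_eq_zero ((mul_eq_zero.1 h1).resolve_right (pow_ne_zero _ hq))
      omega
    intro m n h
    rcases le_total m n with hmn | hmn
    · exact key m n hmn h
    · exact (key n m hmn h.symm).symm
  · simpa only [e] using h n

theorem mulB_pow_single (s : ℕ) (i : ℤ) (j k : ℕ) (x : ℂ) :
    (mulB q ^ s) (Finsupp.single (i, j, k) x) =
      Finsupp.single (i, j + s, k) (x * (qc q ^ (-i)) ^ s) := by
  induction s with
  | zero => simp
  | succ s ih =>
    rw [pow_succ', Module.End.mul_apply, ih, mulB_single, pow_succ]
    simp [mul_assoc, add_assoc]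

theorem mulC_pow_single (s : ℕ) (i : ℤ) (j k : ℕ) (x : ℂ) :
    (mulC q ^ s) (Finsupp.single (i, j, k) x) =
      Finsupp.single (i, j, k + s) (x * (qc q ^ (-i)) ^ s) := by
  induction s with
  | zero => simp
  | succ s ih =>
    rw [pow_succ', Module.End.mul_apply, ih, mulC_single, pow_succ]
    simp [mul_assoc, add_assoc]

theorem haarCoords_mulB_mulC (s t : ℕ) (v : PBW) :
    haarCoords q ((mulB q ^ s * mulC q ^ t) v) =
      v.sum fun m x => if m.1 = 0 ∧ m.2.1 + s = m.2.2 + t then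
        x * ((-qc q) ^ (m.2.1 + s) / qInt q (m.2.1 + s + 1)) else 0 := by
  induction v using Finsupp.induction_linear with
  | zero => simp
  | add v w hv hw =>
    rw [map_add, map_add, hv, hw, Finsupp.sum_add_index']
    · simp
    · intro m x y; split_ifs
      · ring
      · simp
  | single m x =>
    obtain ⟨i, j, k⟩ := m
    rw [Module.End.mul_apply, mulC_pow_single, mulB_pow_single, Finsupp.sum_single_index (by simp)]
    simp only [haarCoords, Finsupp.linearCombination_single]
    split_ifs with h
    · obtain ⟨rfl, _⟩ := h
      simp
    · simp

theorem coeff_zero_of_haarCoords {v : PBW} (h : ∀ f, haarCoords q (pbwRep q f v) = 0) (j k : ℕ) :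
    v (0, j, k) = 0 := by
  classical
  have hq : -qc q ≠ 0 := neg_ne_zero.2 (qc_ne q)
  obtain ⟨ha, hb, hc, hd⟩ := pbwRep_gen q
  have h1 : ∀ s t, haarCoords q ((mulB q ^ s * mulC q ^ t) v) = 0 := by
    intro s t
    have := h (gen q Gen.b ^ s * gen q Gen.c ^ t)
    rwa [map_mul, map_pow, map_pow, hb, hc] at this
  -- the coordinates `(0, r, s)` with `r + k = s + j`, indexed by `r + k`
  have h2 : ∀ n, ∑ r ∈ v.support.image (fun m => m.2.1 + k),
      (if k ≤ r ∧ j ≤ r then v (0, r - k, r - j) * (-qc q) ^ r else 0) / qInt q (r + n + 1) = 0 := by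
    intro n
    -- Multiplying by `b^(k+n) c^(j+n)` selects, for every `n`, the same diagonal of coordinates,
    -- the one through `(0, j, k)`. Only the denominators and an overall factor `(-q)^n` depend on
    -- `n`.
    have h3 := h1 (k + n) (j + n)
    rw [haarCoords_mulB_mulC, Finsupp.sum] at h3
    have h4 : (-qc q) ^ n * ∑ r ∈ v.support.image (fun m => m.2.1 + k),
        (if k ≤ r ∧ j ≤ r then v (0, r - k, r - j) * (-qc q) ^ r else 0) / qInt q (r + n + 1)
        = 0 := by
      refine Eq.trans ?_ h3
      rw [Finset.mul_sum]
      symm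
      rw [← Finset.sum_filter]
      refine Finset.sum_of_injOn (fun m => m.2.1 + k) ?_ ?_ ?_ ?_
      · rintro ⟨i, r, s⟩ hm ⟨i', r', s'⟩ hm' he
        simp only [Finset.coe_filter, Set.mem_ofPred_eq] at hm hm' he
        obtain ⟨_, rfl, h5⟩ := hm
        obtain ⟨_, rfl, h6⟩ := hm'
        simp only [Prod.mk.injEq, true_and]
        omega
      · intro m hm
        simp only [Finset.coe_filter, Set.mem_ofPred_eq] at hm
        exact Finset.mem_coe.2 (Finset.mem_image_of_mem _ hm.1)
      · intro r _ hr
        split_ifs with hk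
        · rw [div_eq_zero_iff.2 (Or.inl _), mul_zero]
          by_contra h7
          refine hr ⟨(0, r - k, r - j), ?_, by simp; omega⟩
          simp only [Finset.coe_filter, Set.mem_ofPred_eq, Finsupp.mem_support_iff]
          exact ⟨left_ne_zero_of_mul h7, by simp, by omega⟩
        · simp
      · rintro ⟨i, r, s⟩ hm
        simp only [Finset.mem_filter] at hm
        obtain ⟨_, rfl, h5⟩ := hm
        have h6 : r + k - j = s := by omega
        simp only
        rw [if_pos (by omega), Nat.add_sub_cancel, h6, ← add_assoc, pow_add]
        ring
    exact (mul_eq_zero.1 h4).resolve_left (pow_ne_zero _ hq)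
  by_contra h8
  -- The index `r = j + k` is the one belonging to the coordinate `(0, j, k)`.
  have h9 := eq_zero_of_sum_div_qInt h2 (r := j + k)
    (Finset.mem_image.2 ⟨(0, j, k), Finsupp.mem_support_iff.2 h8, rfl⟩)
  rw [if_pos (by omega), Nat.add_sub_cancel, Nat.add_sub_cancel_left] at h9
  exact h8 ((mul_eq_zero.1 h9).resolve_right (pow_ne_zero _ hq))

theorem mulD_apply (v : PBW) (i : ℤ) (j k : ℕ) : mulD q v (i - 1, j, k) = v (i, j, k) +
    if 0 < i ∧ 0 < j ∧ 0 < k then qc q ^ (1 - 2 * i) * v (i, j - 1, k - 1) else 0 := by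
  induction v using Finsupp.induction_linear with
  | zero => simp
  | add v w hv hw =>
    rw [map_add, Finsupp.add_apply, hv, hw]
    split_ifs
    · simp; ring
    · simp
  | single m x =>
    obtain ⟨i', j', k'⟩ := m
    rw [mulD_single]
    by_cases h : i' ≤ 0 <;> simp only [h, if_true, if_false, Finsupp.add_apply,
      Finsupp.single_apply, Prod.mk.injEq] <;>
      grind

theorem mulA_apply (v : PBW) (i : ℤ) (j k : ℕ) : mulA q v (i + 1, j, k) = v (i, j, k) +
    if i < 0 ∧ 0 < j ∧ 0 < k then qc q ^ (-2 * i - 1) * v (i, j - 1, k - 1) else 0 := by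
  induction v using Finsupp.induction_linear with
  | zero => simp
  | add v w hv hw =>
    rw [map_add, Finsupp.add_apply, hv, hw]
    split_ifs
    · simp; ring
    · simp
  | single m x =>
    obtain ⟨i', j', k'⟩ := m
    rw [mulA_single]
    by_cases h : 0 ≤ i' <;> simp only [h, if_true, if_false, Finsupp.add_apply,
      Finsupp.single_apply, Prod.mk.injEq] <;>
      grind

theorem eq_zero_of_haarCoords {v : PBW} (h : ∀ f, haarCoords q (pbwRep q f v) = 0) : v = 0 := by
  obtain ⟨ha, _, _, hd⟩ := pbwRep_gen q
  -- Multiplication by `a` or `d` shifts the first exponent up to a correction from a coordinate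
  -- with smaller `j`, so vanishing is pulled back by induction on `j`.
  have hstep : ∀ (T : PBW →ₗ[ℂ] PBW) (i i' : ℤ) (x : ℂ) (P : Prop) [Decidable P] (v : PBW),
      (∀ j k, T v (i', j, k) = v (i, j, k) +
        if P ∧ 0 < j ∧ 0 < k then x * v (i, j - 1, k - 1) else 0) →
      (∀ j k, T v (i', j, k) = 0) → ∀ j k, v (i, j, k) = 0 := by
    intro T i i' x P _ v h1 h2 j
    induction j with
    | zero => intro k; simpa [h2] using (h1 0 k).symm
    | succ j ih => intro k; simpa [h2, ih] using (h1 (j + 1) k).symm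
  have hmul : ∀ (g : SU q) (v : PBW), (∀ f, haarCoords q (pbwRep q f v) = 0) →
      ∀ f, haarCoords q (pbwRep q f (pbwRep q g v)) = 0 := by
    intro g v hv f
    rw [← Module.End.mul_apply, ← map_mul]
    exact hv _
  -- The vectors satisfying the hypothesis are stable under the algebra by `hmul`. Multiplying by
  -- `d` for positive `i`, or by `a` for negative `i`, moves towards the case `i = 0`.
  have key : ∀ (i : ℤ) (v : PBW), (∀ f, haarCoords q (pbwRep q f v) = 0) →
      ∀ j k, v (i, j, k) = 0 := by
    intro i
    induction i using Int.induction_on with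
    | zero => exact fun v hv => coeff_zero_of_haarCoords hv
    | succ n ih =>
      intro v hv
      have := ih _ (hmul (gen q Gen.d) v hv)
      rw [hd] at this
      refine hstep (mulD q) (n + 1) (n + 1 - 1) _ _ v (mulD_apply v _) ?_
      rwa [add_sub_cancel_right]
    | pred n ih =>
      intro v hv
      have := ih _ (hmul (gen q Gen.a) v hv)
      rw [ha] at this
      refine hstep (mulA q) (-n - 1) (-n - 1 + 1) _ _ v (mulA_apply v _) ?_
      rwa [sub_add_cancel]
  ext ⟨i, j, k⟩
  exact key i v h j k

/-- The Haar functional is nondegenerate. -/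
theorem eq_zero_of_haar_mul {g : SU q} (h : ∀ f, haar q (f * g) = 0) : g = 0 := by
  have h1 : normalForm q g = 0 := by
    refine eq_zero_of_haarCoords (q := q) fun f => ?_
    rw [← normalForm_mul, ← haar_eq, h]
  rw [← ofCoords_normalForm g, h1, map_zero]

/-- The inner product `h(f g*)` is nondegenerate on each `ℰ_k`. -/
theorem eq_zero_of_haar_mul_adj {k : ℤ} {g : SU q} (hg : g ∈ E q k)
    (h : ∀ f ∈ E q k, haar q (f * adj g) = 0) : g = 0 := by
  have h1 : adj g = 0 := by
    refine eq_zero_of_haar_mul fun f => ?_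
    refine forall_of_monomial (S := haar q ∘ₗ LinearMap.mulRight ℂ (adj g)) (T := 0)
      (fun i j l => ?_) f
    change haar q (monomial q i j l * adj g) = 0
    have hm := monomial_mem_E (q := q) i j l
    -- A monomial of another degree pairs to zero with `g*` automatically, so testing on `ℰ_k`
    -- amounts to testing on the whole algebra.
    by_cases hk : -i + j - l = k
    · exact h _ (hk ▸ hm)
    · exact haar_eq_zero_of_mem (by omega) (mul_mem_E hm (adj_mem_E hg))
  rw [← adj_adj g, h1, adj_zero]

end Nondegenerate


/-! ### Adjoints and Laplacians -/

section Adjoints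

variable {q : ℝˣ}

/-- `X₊* = -q² X₋` for the inner product `h(f g*)`. -/
theorem haar_convolve_lamPlus_mul_adj {k l : ℤ} (hl : l = k + 2) {f g : SU q} (hf : f ∈ E q k)
    (hg : g ∈ E q l) : haar q (convolve (lamPlus q) f * adj g) =
      -qc q ^ 2 * haar q (f * adj (convolve (lamMinus q) g)) := by
  subst hl
  have hq := qc_ne q
  -- Integration by parts: the Leibniz weight `q^{-k}` meets `q^(k+2)` from `X₊(g*)`, leaving `q²`.
  have h := haar_convolve_lamPlus (f * adj g)
  rw [convolve_lamPlus_mul hf, convolve_lamPlus_adj hg, mul_smul_comm, smul_smul,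
    ← zpow_add₀ hq, neg_add_cancel_left, map_add, map_smul, smul_eq_mul] at h
  norm_cast at h
  linear_combination h

/-- `X₋* = -q⁻² X₊` for the inner product `h(f g*)`. -/
theorem haar_convolve_lamMinus_mul_adj {k l : ℤ} (hl : l = k + 2) {f g : SU q} (hf : f ∈ E q l)
    (hg : g ∈ E q k) : qc q ^ 2 * haar q (convolve (lamMinus q) f * adj g) =
      -haar q (f * adj (convolve (lamPlus q) g)) := by
  have h := congrArg (starRingEnd ℂ) (haar_convolve_lamPlus_mul_adj hl hg hf)
  rw [map_mul (starRingEnd ℂ), ← haar_adj, ← haar_adj, adj_mul, adj_mul, adj_adj, adj_adj,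
    map_neg, map_pow, conj_qc] at h
  linear_combination h

theorem innerProd_eq (ω ν : Forms q) : innerProd q ω ν =
    haar q (ω.1 * adj (ν.1 : SU q)) + haar q (ω.2.1 * adj (ν.2.1 : SU q)) +
      qc q ^ 2 * haar q (ω.2.2.1 * adj (ν.2.2.1 : SU q)) +
      haar q (ω.2.2.2 * adj (ν.2.2.2 : SU q)) := by
  simp only [innerProd, metric, map_add, map_smul, smul_eq_mul]

theorem innerProd_add_left (ω ω' ν : Forms q) :
    innerProd q (ω + ω') ν = innerProd q ω ν + innerProd q ω' ν := by
  simp only [innerProd_eq, Prod.fst_add, Prod.snd_add, Submodule.coe_add, add_mul, map_add]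
  ring

theorem innerProd_add_right (ω ν ν' : Forms q) :
    innerProd q ω (ν + ν') = innerProd q ω ν + innerProd q ω ν' := by
  simp only [innerProd_eq, Prod.fst_add, Prod.snd_add, Submodule.coe_add, adj_add, mul_add,
    map_add]
  ring

theorem eq_zero_of_innerProd {ν : Forms q} (h : ∀ ω, innerProd q ω ν = 0) : ν = 0 := by
  have hq := qc_ne q
  obtain ⟨f, u, v, w⟩ := ν
  have h1 : f = 0 := Subtype.ext (eq_zero_of_haar_mul_adj f.2 fun x hx => by
    simpa [innerProd_eq] using h (⟨x, hx⟩, 0, 0, 0))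
  have h2 : u = 0 := Subtype.ext (eq_zero_of_haar_mul_adj u.2 fun x hx => by
    simpa [innerProd_eq] using h (0, ⟨x, hx⟩, 0, 0))
  have h3 : v = 0 := Subtype.ext (eq_zero_of_haar_mul_adj v.2 fun x hx => by
    simpa [innerProd_eq, hq] using h (0, 0, ⟨x, hx⟩, 0))
  have h4 : w = 0 := Subtype.ext (eq_zero_of_haar_mul_adj w.2 fun x hx => by
    simpa [innerProd_eq] using h (0, 0, 0, ⟨x, hx⟩))
  rw [h1, h2, h3, h4]
  rfl

theorem IsAdjoint.unique {T S S' : Forms q →ₗ[ℂ] Forms q} (h : IsAdjoint T S)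
    (h' : IsAdjoint T S') : S = S' := by
  refine LinearMap.ext fun ν => sub_eq_zero.1 (eq_zero_of_innerProd fun ω => ?_)
  have h1 := innerProd_add_right ω (S ν - S' ν) (S' ν)
  rw [sub_add_cancel, ← h, ← h'] at h1
  linear_combination -h1

theorem IsAdjoint.add {T T' S S' : Forms q →ₗ[ℂ] Forms q} (h : IsAdjoint T S)
    (h' : IsAdjoint T' S') : IsAdjoint (T + T') (S + S') := by
  intro ω ν
  rw [LinearMap.add_apply, LinearMap.add_apply, innerProd_add_left, innerProd_add_right, h, h']

/-- The adjoint of `∂`. -/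
def delAdj (q : ℝˣ) : Forms q →ₗ[ℂ] Forms q where
  toFun ω := (-(qc q ^ 2 • xMinus q 2 0 (by norm_num) ω.2.1), 0,
    -xMinus q 0 (-2) (by norm_num) ω.2.2.2, 0)
  map_add' := by
    intro x y
    simp only [Prod.fst_add, Prod.snd_add, map_add, smul_add, neg_add, Prod.mk_add_mk, add_zero]
  map_smul' := by
    intro r x
    simp only [Prod.smul_fst, Prod.smul_snd, map_smul, Prod.smul_mk, smul_zero, smul_neg,
      RingHom.id_apply, smul_comm r]

/-- The adjoint of `∂̄`. -/
def delbarAdj (q : ℝˣ) : Forms q →ₗ[ℂ] Forms q where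
  toFun ω := (-xPlus q (-2) 0 (by norm_num) ω.2.2.1, xPlus q 0 2 (by norm_num) ω.2.2.2, 0, 0)
  map_add' := by
    intro x y
    simp only [Prod.fst_add, Prod.snd_add, map_add, neg_add, Prod.mk_add_mk, add_zero]
  map_smul' := by
    intro r x
    simp only [Prod.smul_fst, Prod.smul_snd, map_smul, Prod.smul_mk, smul_zero, smul_neg,
      RingHom.id_apply]

@[simp] theorem coe_xPlus {k l : ℤ} (h : l = k + 2) (f : E q k) :
    (xPlus q k l h f : SU q) = convolve (lamPlus q) f := rfl

@[simp] theorem coe_xMinus {k l : ℤ} (h : l = k - 2) (f : E q k) :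
    (xMinus q k l h f : SU q) = convolve (lamMinus q) f := rfl

/-- Both nonzero components use that the adjoint of `X₊` is `-q² X₋`. Into `ℰ_{-2} e⁻` the factor
`q²` is absorbed by the metric, so it appears in only one component of `delAdj`. -/
theorem isAdjoint_del (q : ℝˣ) : IsAdjoint (del q) (delAdj q) := by
  rintro ⟨f, u, v, w⟩ ⟨f', u', v', w'⟩
  have h1 := haar_convolve_lamPlus_mul_adj (by norm_num) f.2 u'.2
  have h2 := haar_convolve_lamPlus_mul_adj (by norm_num) v.2 w'.2
  simp [innerProd_eq, del, delAdj, adj_neg, adj_smul, adj_zero, h1, h2]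

/-- The weight `q²` of the metric on `e⁻` and the factor `-q²` from `e⁻ ∧ e⁺` each cancel the `q⁻²`
in the adjoint of `X₋`. -/
theorem isAdjoint_delbar (q : ℝˣ) : IsAdjoint (delbar q) (delbarAdj q) := by
  rintro ⟨f, u, v, w⟩ ⟨f', u', v', w'⟩
  have h1 : qc q ^ 2 * haar q (convolve (lamMinus q) f * adj (v' : SU q)) =
      -haar q (f * adj (convolve (lamPlus q) v')) :=
    haar_convolve_lamMinus_mul_adj (by norm_num) f.2 v'.2
  have h2 : qc q ^ 2 * haar q (convolve (lamMinus q) u * adj (w' : SU q)) =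
      -haar q (u * adj (convolve (lamPlus q) w')) :=
    haar_convolve_lamMinus_mul_adj (by norm_num) u.2 w'.2
  simp only [innerProd_eq, delbar, delbarAdj, LinearMap.coe_mk, AddHom.coe_mk, adj_neg, adj_zero,
    Submodule.coe_neg, Submodule.coe_smul, Submodule.coe_zero, coe_xMinus, coe_xPlus, neg_mul,
    smul_mul_assoc, map_neg, map_smul, smul_eq_mul, mul_neg, h1, h2, mul_zero, zero_mul, map_zero]
  ring

theorem isAdjoint_iff {T S : Forms q →ₗ[ℂ] Forms q} (h : IsAdjoint T S)
    (S' : Forms q →ₗ[ℂ] Forms q) : IsAdjoint T S' ↔ S' = S :=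
  ⟨fun h' => h'.unique h, fun h' => h' ▸ h⟩

/-! ### Anticommutators and Laplacians -/

theorem anti_del_delbarAdj (q : ℝˣ) : anti (del q) (delbarAdj q) = 0 := by
  refine LinearMap.ext fun ⟨f, u, v, w⟩ => ?_
  simp [anti, del, delbarAdj]

theorem anti_delbar_delAdj (q : ℝˣ) : anti (delbar q) (delAdj q) = 0 := by
  refine LinearMap.ext fun ⟨f, u, v, w⟩ => ?_
  simp [anti, delbar, delAdj]

theorem convolve_comm_zero {f : SU q} (hf : f ∈ E q 0) :
    convolve (lamPlus q) (convolve (lamMinus q) f) =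
      qc q ^ 2 • convolve (lamMinus q) (convolve (lamPlus q) f) := by
  rw [convolve_comm hf, commScalar_zero, zero_smul, add_zero]

/-- On one-forms the two sides agree term by term. On functions and two-forms they are `-q² X₋X₊`
and `-X₊X₋` in one order or the other, equal by the commutation relation on `ℰ_0`. -/
theorem anti_del_delAdj (q : ℝˣ) :
    anti (del q) (delAdj q) = anti (delbar q) (delbarAdj q) := by
  refine LinearMap.ext fun ⟨f, u, v, w⟩ => ?_
  have hf := convolve_comm_zero f.2
  have hw := convolve_comm_zero w.2
  simp only [anti, del, delbar, delAdj, delbarAdj, LinearMap.add_apply, LinearMap.comp_apply,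
    LinearMap.coe_mk, AddHom.coe_mk, Prod.mk_add_mk, Prod.mk.injEq]
  refine ⟨Subtype.ext ?_, Subtype.ext ?_, Subtype.ext ?_, Subtype.ext ?_⟩ <;>
    simp [hf, hw]

theorem del_comp_del (q : ℝˣ) : del q ∘ₗ del q = 0 := by
  refine LinearMap.ext fun ⟨f, u, v, w⟩ => ?_
  simp [del]

theorem delbar_comp_delbar (q : ℝˣ) : delbar q ∘ₗ delbar q = 0 := by
  refine LinearMap.ext fun ⟨f, u, v, w⟩ => ?_
  simp [delbar]

theorem delAdj_comp_delAdj (q : ℝˣ) : delAdj q ∘ₗ delAdj q = 0 := by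
  refine LinearMap.ext fun ⟨f, u, v, w⟩ => ?_
  simp [delAdj]

theorem delbarAdj_comp_delbarAdj (q : ℝˣ) : delbarAdj q ∘ₗ delbarAdj q = 0 := by
  refine LinearMap.ext fun ⟨f, u, v, w⟩ => ?_
  simp [delbarAdj]

/-- `∂` and `∂̄` anticommute, because `X₊ X₋ = q² X₋ X₊` on `ℰ_0`. -/
theorem anti_del_delbar (q : ℝˣ) : anti (del q) (delbar q) = 0 := by
  refine LinearMap.ext fun ⟨f, u, v, w⟩ => ?_
  have hf := convolve_comm_zero f.2
  simp only [anti, del, delbar, LinearMap.add_apply, LinearMap.comp_apply, LinearMap.zero_apply,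
    LinearMap.coe_mk, AddHom.coe_mk, Prod.mk_add_mk]
  refine Prod.ext ?_ (Prod.ext ?_ (Prod.ext ?_ (Subtype.ext ?_))) <;> simp [hf]

theorem anti_delAdj_delbarAdj (q : ℝˣ) : anti (delAdj q) (delbarAdj q) = 0 := by
  refine LinearMap.ext fun ⟨f, u, v, w⟩ => ?_
  have hw := convolve_comm_zero w.2
  simp only [anti, delAdj, delbarAdj, LinearMap.add_apply, LinearMap.comp_apply,
    LinearMap.zero_apply, LinearMap.coe_mk, AddHom.coe_mk, Prod.mk_add_mk]
  refine Prod.ext (Subtype.ext ?_) (Prod.ext ?_ (Prod.ext ?_ ?_)) <;> simp [hw]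

theorem laplacian_eq_anti {T S : Forms q →ₗ[ℂ] Forms q} (hT : T ∘ₗ T = 0) (hS : S ∘ₗ S = 0) :
    laplacian T S = anti T S := by
  simp only [laplacian, dirac, anti, LinearMap.add_comp, LinearMap.comp_add, hT, hS]
  abel

theorem anti_add_left (S S' T : Forms q →ₗ[ℂ] Forms q) :
    anti (S + S') T = anti S T + anti S' T := by
  simp only [anti, LinearMap.add_comp, LinearMap.comp_add]
  abel

theorem anti_comm (S T : Forms q →ₗ[ℂ] Forms q) : anti S T = anti T S := add_comm _ _

theorem add_comp_add_eq_zero {S T : Forms q →ₗ[ℂ] Forms q} (hS : S ∘ₗ S = 0) (hT : T ∘ₗ T = 0)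
    (h : anti S T = 0) : (S + T) ∘ₗ (S + T) = 0 := by
  have : (S + T) ∘ₗ (S + T) = S ∘ₗ S + T ∘ₗ T + anti S T := by
    simp only [anti, LinearMap.add_comp, LinearMap.comp_add]
    abel
  rw [this, hS, hT, h, add_zero, add_zero]

/-- With `d² = 0` and `(d*)² = 0` the Laplacian is `(∂ + ∂̄, ∂* + ∂̄*)`. Its mixed terms vanish and
the two diagonal terms coincide, whence the factor `2`. -/
theorem laplacian_extd (q : ℝˣ) : laplacian (extd q) (delAdj q + delbarAdj q) =
    (2 : ℂ) • laplacian (del q) (delAdj q) := by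
  have h1 : extd q ∘ₗ extd q = 0 :=
    add_comp_add_eq_zero (del_comp_del q) (delbar_comp_delbar q) (anti_del_delbar q)
  have h2 := add_comp_add_eq_zero (delAdj_comp_delAdj q) (delbarAdj_comp_delbarAdj q)
    (anti_delAdj_delbarAdj q)
  rw [laplacian_eq_anti h1 h2, laplacian_eq_anti (del_comp_del q) (delAdj_comp_delAdj q), extd,
    anti_add_left, anti_comm (del q), anti_comm (delbar q), anti_add_left, anti_add_left,
    anti_comm _ (del q), anti_comm _ (del q), anti_comm _ (delbar q), anti_comm _ (delbar q),
    anti_del_delbarAdj, anti_delbar_delAdj, ← anti_del_delAdj, two_smul, add_zero, zero_add]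

end Adjoints

end Podles
end

open Podles in
theorem mainTheorem5 (q : ℝˣ) :
    ∃ dS delS delbarS : Forms q →ₗ[ℂ] Forms q,
      (∀ S, IsAdjoint (extd q) S ↔ S = dS) ∧
      (∀ S, IsAdjoint (del q) S ↔ S = delS) ∧
      (∀ S, IsAdjoint (delbar q) S ↔ S = delbarS) ∧
      anti (del q) delbarS = 0 ∧
      anti (delbar q) delS = 0 ∧
      anti (del q) delS = anti (delbar q) delbarS ∧
      laplacian (extd q) dS = (2 : ℂ) • laplacian (del q) delS ∧
      laplacian (extd q) dS = (2 : ℂ) • laplacian (delbar q) delbarS := by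
  refine ⟨delAdj q + delbarAdj q, delAdj q, delbarAdj q,
    isAdjoint_iff ((isAdjoint_del q).add (isAdjoint_delbar q)), isAdjoint_iff (isAdjoint_del q),
    isAdjoint_iff (isAdjoint_delbar q), anti_del_delbarAdj q, anti_delbar_delAdj q,
    anti_del_delAdj q, laplacian_extd q, ?_⟩
  rw [laplacian_extd, laplacian_eq_anti (del_comp_del q) (delAdj_comp_delAdj q),
    laplacian_eq_anti (delbar_comp_delbar q) (delbarAdj_comp_delbarAdj q), anti_del_delAdj]
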